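/- Let $\Lambda$ be a finite dimensional hereditary algebra over a field $K$. All modules are right modules. Let $S_1,\dots,S_n$ be the simple $\Lambda$-modules, one from each isomorphism class, let $P_i\to S_i$ be a projective cover of $S_i$, and write $rX$ for the radical of a module $X$ and $r^2X=r(rX)$. Put $F_i=\operatorname{End}_\Lambda(P_i)$; this is a finite dimensional division algebra over $K$ and is identified with $\operatorname{End}_\Lambda(S_i)$ through $P_i\to S_i$. The associated modulated quiver $(Q,\mathcal M)$ has vertices $1,\dots,n$, an arrow $i\to j$ whenever $\operatorname{Ext}^1_\Lambda(S_i,S_j)\neq 0$, the division algebra $F_i$ at the vertex $i$, and on each arrow $i\to j$ the $F_i$-$F_j$-bimodule $M_{ij}=\operatorname{Hom}_\Lambda(P_j,rP_i/r^2P_i)$, on which $F_i$ and $F_j$ act by composition. Its tensor algebra $$T(Q,\mathcal M)=\bigoplus M_{j_0j_1}\otimes_{F_{j_1}}M_{j_1j_2}\otimes_{F_{j_2}}\cdots\otimes_{F_{j_{r-1}}}M_{j_{r-1}j_r}$$ is the direct sum over all paths $j_0\to j_1\to\cdots\to j_r$ in $Q$, including the paths of length zero (which contribute the $F_j$), with multiplication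 given by concatenation of paths. Then $\Lambda$ is Morita equivalent to $T(Q,\mathcal M)$ (that is, their categories of modules are equivalent as $K$-linear categories) if and only if, for each arrow $i\to j$ of $Q$, the epimorphism of $F_i$-$F_j$-bimodules $$\operatorname{Hom}_\Lambda(P_j,rP_i)\twoheadrightarrow M_{ij}=\operatorname{Hom}_\Lambda(P_j,rP_i/r^2P_i)$$ induced by the projection $rP_i\to rP_i/r^2P_i$ has a section that is a homomorphism of $F_i$-$F_j$-bimodules. -/

import Mathlib

open scoped TensorProduct
open CategoryTheory

universe u v w

/-! ## Tensor products over a noncommutative algebra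

Throughout, a right `F`-module is a module over `Fᵐᵒᵖ`; `MulOpposite.op f • x` is `x · f`. -/

section Balanced

variable (K : Type u) [Field K] (F : Type v) [Ring F]
variable (X : Type v) [AddCommGroup X] [Module K X] [Module Fᵐᵒᵖ X]
variable (Y : Type v) [AddCommGroup Y] [Module K Y] [Module F Y]

/-- The relations `x f ⊗ y = x ⊗ f y`. -/
def balancedRelations : Submodule K (X ⊗[K] Y) :=
  Submodule.span K {t | ∃ (x : X) (f : F) (y : Y),
    t = (MulOpposite.op f • x) ⊗ₜ[K] y - x ⊗ₜ[K] (f • y)}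

/-- The tensor product `X ⊗_F Y` of a right module `X` and a left module `Y` over a
`K`-algebra `F`. -/
def BalancedTensor : Type v := (X ⊗[K] Y) ⧸ balancedRelations K F X Y

namespace BalancedTensor

noncomputable instance : AddCommGroup (BalancedTensor K F X Y) :=
  inferInstanceAs (AddCommGroup ((X ⊗[K] Y) ⧸ balancedRelations K F X Y))

noncomputable instance : Module K (BalancedTensor K F X Y) :=
  inferInstanceAs (Module K ((X ⊗[K] Y) ⧸ balancedRelations K F X Y))

/-- The quotient map `X ⊗_K Y → X ⊗_F Y`. -/
noncomputable def proj : (X ⊗[K] Y) →ₗ[K] BalancedTensor K F X Y :=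
  (balancedRelations K F X Y).mkQ

variable {X Y}

/-- The pure tensor `x ⊗ y` in `X ⊗_F Y`. -/
noncomputable def tmul (x : X) (y : Y) : BalancedTensor K F X Y := proj K F X Y (x ⊗ₜ[K] y)

variable {K F}

theorem smul_tmul (x : X) (f : F) (y : Y) :
    tmul K F (MulOpposite.op f • x) y = tmul K F x (f • y) :=
  (Submodule.Quotient.eq _).2 (Submodule.subset_span ⟨x, f, y, rfl⟩)

theorem hom_ext {Z : Type w} [AddCommGroup Z] [Module K Z]
    {g h : BalancedTensor K F X Y →ₗ[K] Z}
    (H : ∀ x y, g (tmul K F x y) = h (tmul K F x y)) : g = h := by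
  apply Submodule.linearMap_qext
  exact TensorProduct.ext' H

/-- The linear map out of `X ⊗_F Y` given by an `F`-balanced bilinear map. -/
noncomputable def lift {Z : Type w} [AddCommGroup Z] [Module K Z] (b : X →ₗ[K] Y →ₗ[K] Z)
    (hb : ∀ (x : X) (f : F) (y : Y), b (MulOpposite.op f • x) y = b x (f • y)) :
    BalancedTensor K F X Y →ₗ[K] Z :=
  (balancedRelations K F X Y).liftQ (TensorProduct.lift b) (by
    rw [balancedRelations, Submodule.span_le]
    rintro _ ⟨x, f, y, rfl⟩
    simp [hb])

@[simp] theorem lift_tmul {Z : Type w} [AddCommGroup Z] [Module K Z] (b : X →ₗ[K] Y →ₗ[K] Z)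
    (hb : ∀ (x : X) (f : F) (y : Y), b (MulOpposite.op f • x) y = b x (f • y)) (x : X) (y : Y) :
    lift b hb (tmul K F x y) = b x y := by
  change TensorProduct.lift b (x ⊗ₜ[K] y) = b x y
  simp

theorem add_tmul (x x' : X) (y : Y) :
    tmul K F (x + x') y = tmul K F x y + tmul K F x' y := by
  simp [tmul, TensorProduct.add_tmul]

theorem tmul_add (x : X) (y y' : Y) :
    tmul K F x (y + y') = tmul K F x y + tmul K F x y' := by
  simp [tmul, TensorProduct.tmul_add]

theorem smul_tmul_left (k : K) (x : X) (y : Y) : tmul K F (k • x) y = k • tmul K F x y := by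
  rw [tmul, ← TensorProduct.smul_tmul', map_smul]; rfl

theorem smul_tmul_right (k : K) (x : X) (y : Y) : tmul K F x (k • y) = k • tmul K F x y := by
  simp [tmul]

variable (K F X Y) in
/-- The universal balanced bilinear map `(x, y) ↦ x ⊗ y`. -/
noncomputable def mk : X →ₗ[K] Y →ₗ[K] BalancedTensor K F X Y :=
  LinearMap.mk₂ K (tmul K F) add_tmul smul_tmul_left tmul_add smul_tmul_right

@[simp] theorem mk_apply (x : X) (y : Y) : mk K F X Y x y = tmul K F x y := rfl

section Right

variable {G : Type v} [Ring G] [Algebra K G] [Module Gᵐᵒᵖ Y] [IsScalarTower K Gᵐᵒᵖ Y]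
  [SMulCommClass F Gᵐᵒᵖ Y]

/-- Right multiplication `x ⊗ y ↦ x ⊗ y g`. -/
noncomputable def rightMul (g : Gᵐᵒᵖ) : BalancedTensor K F X Y →ₗ[K] BalancedTensor K F X Y :=
  lift ((mk K F X Y).compl₂ (Module.toModuleEnd K (S := Gᵐᵒᵖ) Y g)) (fun x f y => by
    simp [smul_tmul, smul_comm f g y])

@[simp] theorem rightMul_tmul (g : Gᵐᵒᵖ) (x : X) (y : Y) :
    rightMul (K := K) (F := F) g (tmul K F x y) = tmul K F x (g • y) := by
  simp [rightMul]

/-- If `Y` is an `F`-`G`-bimodule, then `X ⊗_F Y` is a right `G`-module. -/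
noncomputable instance : Module Gᵐᵒᵖ (BalancedTensor K F X Y) where
  smul g t := rightMul g t
  one_smul t := by
    change rightMul (1 : Gᵐᵒᵖ) t = LinearMap.id (R := K) t
    exact LinearMap.congr_fun (hom_ext (fun x y => by simp)) t
  mul_smul g h t := by
    change rightMul (g * h) t = ((rightMul g).comp (rightMul h)) t
    exact LinearMap.congr_fun (hom_ext (fun x y => by simp [mul_smul])) t
  smul_zero g := map_zero (rightMul g)
  smul_add g := map_add (rightMul g)
  add_smul g h t := by
    change rightMul (K := K) (g + h) t = (rightMul (K := K) g + rightMul h : _ →ₗ[K] _) t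
    exact LinearMap.congr_fun (hom_ext (fun x y => by simp [add_smul, tmul_add])) t
  zero_smul t := by
    change rightMul (0 : Gᵐᵒᵖ) t = (0 : BalancedTensor K F X Y →ₗ[K] _) t
    exact LinearMap.congr_fun (hom_ext (fun x y => by rw [rightMul_tmul, zero_smul]; simp [tmul])) t

theorem right_smul_tmul (g : Gᵐᵒᵖ) (x : X) (y : Y) :
    g • tmul K F x y = tmul K F x (g • y) := rightMul_tmul g x y

instance : IsScalarTower K Gᵐᵒᵖ (BalancedTensor K F X Y) where
  smul_assoc k g t := by
    change rightMul (k • g) t = (k • rightMul g) t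
    exact LinearMap.congr_fun (hom_ext (fun x y => by simp [smul_tmul_right])) t

theorem extendRight_balanced {Z N : Type v} [AddCommGroup Z]
    [Module K Z] [Module Fᵐᵒᵖ Z] [AddCommGroup N] [Module K N] [Module F N]
    (c : X →ₗ[K] Z) (hc : ∀ x (g : Fᵐᵒᵖ), c (g • x) = g • c x) (x : X) (f : F) (m : N) :
    (mk K F Z N).comp c (MulOpposite.op f • x) m = (mk K F Z N).comp c x (f • m) := by
  rw [LinearMap.comp_apply, LinearMap.comp_apply, mk_apply, mk_apply, hc, smul_tmul]

/-- Given `c : W → X → Z` bilinear, and right `F`-linear in the second variable, the map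
`(w, x ⊗ m) ↦ c w x ⊗ m`. -/
noncomputable def extendRight {W Z N : Type v} [AddCommGroup W] [Module K W] [AddCommGroup Z]
    [Module K Z] [Module Fᵐᵒᵖ Z] [AddCommGroup N] [Module K N] [Module F N]
    (c : W →ₗ[K] X →ₗ[K] Z) (hc : ∀ w x (g : Fᵐᵒᵖ), c w (g • x) = g • c w x) :
    W →ₗ[K] BalancedTensor K F X N →ₗ[K] BalancedTensor K F Z N where
  toFun w := lift ((mk K F Z N).comp (c w)) (extendRight_balanced (c w) (hc w))
  map_add' w w' := hom_ext (fun x m => by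
    rw [LinearMap.add_apply, lift_tmul, lift_tmul, lift_tmul]; simp)
  map_smul' k w := hom_ext (fun x m => by
    rw [LinearMap.smul_apply, lift_tmul, lift_tmul]; simp)

@[simp] theorem extendRight_tmul {W Z N : Type v} [AddCommGroup W] [Module K W] [AddCommGroup Z]
    [Module K Z] [Module Fᵐᵒᵖ Z] [AddCommGroup N] [Module K N] [Module F N]
    (c : W →ₗ[K] X →ₗ[K] Z) (hc : ∀ w x (g : Fᵐᵒᵖ), c w (g • x) = g • c w x)
    (w : W) (x : X) (m : N) :
    extendRight c hc w (tmul K F x m) = tmul K F (c w x) m :=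
  lift_tmul ((mk K F Z N).comp (c w)) (extendRight_balanced (c w) (hc w)) x m

theorem extendRight_smul {W Z : Type v} [AddCommGroup W] [Module K W] [AddCommGroup Z]
    [Module K Z] [Module Fᵐᵒᵖ Z]
    (c : W →ₗ[K] X →ₗ[K] Z) (hc : ∀ w x (g : Fᵐᵒᵖ), c w (g • x) = g • c w x)
    (w : W) (t : BalancedTensor K F X Y) (g : Gᵐᵒᵖ) :
    extendRight c hc w (g • t) = g • extendRight c hc w t := by
  have h : (extendRight c hc w).comp (rightMul g) =
      (rightMul g).comp (extendRight (N := Y) c hc w) :=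
    hom_ext (fun y m => by simp)
  exact LinearMap.congr_fun h t

end Right

end BalancedTensor

end Balanced

/-! ## Modulated quivers and their tensor algebras -/

set_option linter.checkUnivs false in
/-- A modulated quiver over a field `K`: a finite quiver without oriented cycles and without
multiple arrows, a finite dimensional division algebra `F i` over `K` at each vertex, and a finite
dimensional `F i`-`F j`-bimodule `M i j` (on which `K` acts centrally) for each arrow `i → j`. -/
structure ModulatedQuiver (K : Type u) [Field K] where
  V : Type w
  [fintypeV : Fintype V]
  Arrow : V → V → Prop
  acyclic : ∀ i, ¬ Relation.TransGen Arrow i i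
  F : V → Type v
  [divisionRingF : ∀ i, DivisionRing (F i)]
  [algebraF : ∀ i, Algebra K (F i)]
  [finiteF : ∀ i, Module.Finite K (F i)]
  M : ∀ i j, Arrow i j → Type v
  [addCommGroupM : ∀ i j a, AddCommGroup (M i j a)]
  [moduleM : ∀ i j a, Module K (M i j a)]
  [leftModuleM : ∀ i j a, Module (F i) (M i j a)]
  [rightModuleM : ∀ i j a, Module (F j)ᵐᵒᵖ (M i j a)]
  [bimoduleM : ∀ i j a, SMulCommClass (F i) (F j)ᵐᵒᵖ (M i j a)]
  [leftTowerM : ∀ i j a, IsScalarTower K (F i) (M i j a)]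
  [rightTowerM : ∀ i j a, IsScalarTower K (F j)ᵐᵒᵖ (M i j a)]
  [finiteM : ∀ i j a, Module.Finite K (M i j a)]

namespace ModulatedQuiver

attribute [instance] fintypeV divisionRingF algebraF finiteF addCommGroupM moduleM leftModuleM
  rightModuleM bimoduleM leftTowerM rightTowerM finiteM

variable {K : Type u} [Field K]

/-- A right module over a `K`-algebra `F`, bundled together with its `K`-module structure. -/
structure RightModule (K : Type u) [Field K] (F : Type v) [Ring F] [Algebra K F] where
  carrier : Type v
  [addCommGroup : AddCommGroup carrier]
  [moduleK : Module K carrier]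
  [moduleF : Module Fᵐᵒᵖ carrier]
  [tower : IsScalarTower K Fᵐᵒᵖ carrier]

attribute [instance] RightModule.addCommGroup RightModule.moduleK RightModule.moduleF
  RightModule.tower

variable (Q : ModulatedQuiver.{u, v, w} K)

/-- The vertices of `Q` as a quiver. -/
instance quiverV : Quiver.{0} Q.V := ⟨fun i j => PLift (Q.Arrow i j)⟩

/-- The bimodule on an arrow. -/
abbrev bimodule {i j : Q.V} (a : i ⟶ j) : Type v := Q.M i j a.down

/-- The tensor path `M_{j₀ j₁} ⊗ M_{j₁ j₂} ⊗ ⋯ ⊗ M_{j_{r-1} j_r}` (tensor products over the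
`F_j` at the inner vertices) of a path `j₀ → j₁ → ⋯ → j_r`, as a right module over `F_{j_r}`. It is
`F_j` on the path of length zero at `j`, and `F_{j₀} ⊗_{F_{j₀}} M_{j₀ j₁} ⊗ ⋯` otherwise. -/
noncomputable def pathModule {i : Q.V} : ∀ {j : Q.V}, Quiver.Path i j → RightModule K (Q.F j)
  | _, .nil => { carrier := Q.F i }
  | _, .cons (b := b) p a =>
      { carrier := BalancedTensor K (Q.F b) (pathModule p).carrier (Q.bimodule a) }

/-- The underlying space of `pathModule`. -/
abbrev TensorPath {i j : Q.V} (p : Quiver.Path i j) : Type v := (Q.pathModule p).carrier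

/-- The space attached to the path of length zero at `i` is `F i`. -/
noncomputable def nilEquiv (i : Q.V) : Q.F i ≃ₗ[K] Q.TensorPath (.nil : Quiver.Path i i) :=
  LinearEquiv.refl K (Q.F i)

theorem smul_nilEquiv (i : Q.V) (f : Q.F i) (g : (Q.F i)ᵐᵒᵖ) :
    g • Q.nilEquiv i f = Q.nilEquiv i (f * g.unop) := rfl

/-- The space attached to a path that ends in the arrow `a`. -/
noncomputable def consEquiv {i j k : Q.V} (p : Quiver.Path i j) (a : j ⟶ k) :
    BalancedTensor K (Q.F j) (Q.TensorPath p) (Q.bimodule a) ≃ₗ[K] Q.TensorPath (p.cons a) :=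
  LinearEquiv.refl K (BalancedTensor K (Q.F j) (Q.TensorPath p) (Q.bimodule a))

theorem smul_consEquiv {i j k : Q.V} (p : Quiver.Path i j) (a : j ⟶ k)
    (t : BalancedTensor K (Q.F j) (Q.TensorPath p) (Q.bimodule a)) (g : (Q.F k)ᵐᵒᵖ) :
    g • Q.consEquiv p a t = Q.consEquiv p a (g • t) := rfl

/-- The pure tensor `t ⊗ m` attached to a path that ends in the arrow `a`. -/
noncomputable def snoc {i j k : Q.V} {p : Quiver.Path i j} (t : Q.TensorPath p) (a : j ⟶ k)
    (m : Q.bimodule a) : Q.TensorPath (p.cons a) :=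
  Q.consEquiv p a (BalancedTensor.tmul K (Q.F j) t m)

/-- The right action of `F j` on a tensor path that ends at `j`, as a bilinear map. -/
noncomputable def rightAct {i j : Q.V} (p : Quiver.Path i j) :
    Q.TensorPath p →ₗ[K] Q.F j →ₗ[K] Q.TensorPath p :=
  LinearMap.mk₂ K (fun (x : Q.TensorPath p) (f : Q.F j) => MulOpposite.op f • x)
    (fun x x' f => smul_add _ x x')
    (fun k x f => (smul_comm k (MulOpposite.op f) x).symm)
    (fun x f f' => by rw [MulOpposite.op_add, add_smul])
    (fun k x f => by rw [MulOpposite.op_smul, smul_assoc])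

/-- Concatenation of tensor paths `(x, y) ↦ x ⊗ y`, together with its compatibility with the
right action of the division algebra at the end vertex. For a second path of length zero it is the
right action of `F_j`, and `x ⊗ (t ⊗ m) = (x ⊗ t) ⊗ m`. -/
noncomputable def concatAux {i j : Q.V} (p : Quiver.Path i j) : ∀ {k : Q.V} (q : Quiver.Path j k),
    { c : Q.TensorPath p →ₗ[K] Q.TensorPath q →ₗ[K] Q.TensorPath (p.comp q) //
      ∀ x y (g : (Q.F k)ᵐᵒᵖ), c x (g • y) = g • c x y }
  | _, .nil => ⟨(Q.rightAct p).compl₂ (Q.nilEquiv j).symm.toLinearMap, fun x y g => by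
      obtain ⟨f, rfl⟩ := (Q.nilEquiv j).surjective y
      change Q.rightAct p x (f * g.unop) = g • Q.rightAct p x f
      simp only [rightAct, LinearMap.mk₂_apply]
      rw [MulOpposite.op_mul, mul_smul, MulOpposite.op_unop]⟩
  | _, .cons q a =>
      ⟨((BalancedTensor.extendRight (concatAux p q).1 (concatAux p q).2).compl₂
          (Q.consEquiv q a).symm.toLinearMap).compr₂ (Q.consEquiv (p.comp q) a).toLinearMap,
        fun x y g => BalancedTensor.extendRight_smul (concatAux p q).1 (concatAux p q).2 x
          ((Q.consEquiv q a).symm y) g⟩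

/-- Concatenation of tensor paths. -/
noncomputable def concat {i j k : Q.V} (p : Quiver.Path i j) (q : Quiver.Path j k) :
    Q.TensorPath p →ₗ[K] Q.TensorPath q →ₗ[K] Q.TensorPath (p.comp q) :=
  (Q.concatAux p q).1

theorem concat_smul {i j k : Q.V} (p : Quiver.Path i j) (q : Quiver.Path j k)
    (x : Q.TensorPath p) (y : Q.TensorPath q) (g : (Q.F k)ᵐᵒᵖ) :
    Q.concat p q x (g • y) = g • Q.concat p q x y := (Q.concatAux p q).2 x y g

theorem concat_nil {i j : Q.V} (p : Quiver.Path i j) (x : Q.TensorPath p) (f : Q.F j) :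
    Q.concat p .nil x (Q.nilEquiv j f) = MulOpposite.op f • x := rfl

theorem concat_snoc {i j k l : Q.V} (p : Quiver.Path i j) (q : Quiver.Path j k) (a : k ⟶ l)
    (x : Q.TensorPath p) (t : Q.TensorPath q) (m : Q.bimodule a) :
    Q.concat p (q.cons a) x (Q.snoc t a m) = Q.snoc (Q.concat p q x t) a m :=
  congrArg (Q.consEquiv (p.comp q) a)
    (BalancedTensor.extendRight_tmul (Q.concatAux p q).1 (Q.concatAux p q).2 x t m)

open Classical in
/-- The direct sum of all tensor paths from `i` to `j`. -/
abbrev PathSum (i j : Q.V) : Type (max v w) :=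
  DirectSum (Quiver.Path i j) (fun p => Q.TensorPath p)

open Classical in
/-- The inclusion of a tensor path in the direct sum. -/
noncomputable def incl {i j : Q.V} (p : Quiver.Path i j) : Q.TensorPath p →ₗ[K] Q.PathSum i j :=
  DirectSum.lof K _ _ p

open Classical in
theorem pathSum_hom_ext {i j : Q.V} {Z : Type*} [AddCommGroup Z] [Module K Z]
    {g h : Q.PathSum i j →ₗ[K] Z} (H : ∀ p x, g (Q.incl p x) = h (Q.incl p x)) : g = h :=
  DirectSum.linearMap_ext K (fun p => LinearMap.ext (H p))

open Classical in
/-- Concatenation on the direct sums of tensor paths. -/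
noncomputable def comp (i j k : Q.V) :
    Q.PathSum i j →ₗ[K] Q.PathSum j k →ₗ[K] Q.PathSum i k :=
  DirectSum.toModule K _ _ (fun p => LinearMap.flip (DirectSum.toModule K _ _ (fun q =>
    LinearMap.flip ((Q.concat p q).compr₂ (Q.incl (p.comp q))))))

theorem comp_incl {i j k : Q.V} (p : Quiver.Path i j) (q : Quiver.Path j k)
    (x : Q.TensorPath p) (y : Q.TensorPath q) :
    Q.comp i j k (Q.incl p x) (Q.incl q y) = Q.incl (p.comp q) (Q.concat p q x y) := by
  simp [comp, incl]

/-- The element `1 ∈ F_i` on the path of length zero. -/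
noncomputable def idPath (i : Q.V) : Q.PathSum i i := Q.incl .nil (Q.nilEquiv i 1)

open Classical in
/-- Right concatenation with an element of an arrow bimodule. -/
noncomputable def extend {i j k : Q.V} (a : j ⟶ k) (m : Q.bimodule a) :
    Q.PathSum i j →ₗ[K] Q.PathSum i k :=
  DirectSum.toModule K _ _ (fun p => (Q.incl (p.cons a)).comp ((Q.consEquiv p a).toLinearMap.comp
    ((BalancedTensor.mk K (Q.F j) (Q.TensorPath p) (Q.bimodule a)).flip m)))

theorem extend_incl {i j k : Q.V} (a : j ⟶ k) (m : Q.bimodule a) (p : Quiver.Path i j)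
    (t : Q.TensorPath p) : Q.extend a m (Q.incl p t) = Q.incl (p.cons a) (Q.snoc t a m) := by
  simp only [extend, incl, DirectSum.toModule_lof]
  rfl

theorem tensorPath_cons_ext {i j k : Q.V} {p : Quiver.Path i j} {a : j ⟶ k} {Z : Type*}
    [AddCommGroup Z] [Module K Z] {g h : Q.TensorPath (p.cons a) →ₗ[K] Z}
    (H : ∀ t m, g (Q.snoc t a m) = h (Q.snoc t a m)) : g = h :=
  BalancedTensor.hom_ext (F := Q.F j) (X := Q.TensorPath p) (Y := Q.bimodule a) H

theorem comp_id {i j : Q.V} (x : Q.PathSum i j) : Q.comp i j j x (Q.idPath j) = x := by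
  have : (Q.comp i j j).flip (Q.idPath j) = LinearMap.id :=
    Q.pathSum_hom_ext (fun p x => by
      rw [LinearMap.flip_apply, idPath, comp_incl, concat_nil, MulOpposite.op_one, one_smul]; rfl)
  exact LinearMap.congr_fun this x

theorem id_concat {i j : Q.V} (p : Quiver.Path i j) (x : Q.TensorPath p) :
    Q.incl (Quiver.Path.nil.comp p) (Q.concat .nil p (Q.nilEquiv i 1) x) = Q.incl p x := by
  induction p with
  | nil =>
    obtain ⟨f, rfl⟩ := (Q.nilEquiv i).surjective x
    rw [concat_nil, smul_nilEquiv, MulOpposite.unop_op, one_mul]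
    rfl
  | cons p a ih =>
    refine LinearMap.congr_fun (Q.tensorPath_cons_ext (g := (Q.incl (Quiver.Path.nil.comp
      (p.cons a))).comp (Q.concat .nil (p.cons a) (Q.nilEquiv i 1))) (fun t m => ?_)) x
    rw [LinearMap.comp_apply, concat_snoc]
    refine (Q.extend_incl a m _ _).symm.trans ?_
    rw [ih, extend_incl]

theorem id_comp {i j : Q.V} (x : Q.PathSum i j) : Q.comp i i j (Q.idPath i) x = x := by
  have : Q.comp i i j (Q.idPath i) = LinearMap.id :=
    Q.pathSum_hom_ext (fun p x => by rw [idPath, comp_incl, id_concat]; rfl)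
  exact LinearMap.congr_fun this x

theorem concat_assoc {i j k l : Q.V} (p : Quiver.Path i j) (q : Quiver.Path j k)
    (r : Quiver.Path k l) (x : Q.TensorPath p) (y : Q.TensorPath q) (z : Q.TensorPath r) :
    Q.incl ((p.comp q).comp r) (Q.concat (p.comp q) r (Q.concat p q x y) z) =
      Q.incl (p.comp (q.comp r)) (Q.concat p (q.comp r) x (Q.concat q r y z)) := by
  induction r with
  | nil =>
    obtain ⟨f, rfl⟩ := (Q.nilEquiv k).surjective z
    rw [concat_nil, concat_nil]
    exact congrArg (Q.incl (p.comp q)) (Q.concat_smul p q x y (MulOpposite.op f)).symm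
  | cons r a ih =>
    refine LinearMap.congr_fun (Q.tensorPath_cons_ext
      (g := (Q.incl ((p.comp q).comp (r.cons a))).comp
        (Q.concat (p.comp q) (r.cons a) (Q.concat p q x y)))
      (h := (Q.incl (p.comp (q.comp (r.cons a)))).comp
        ((Q.concat p (q.comp (r.cons a)) x).comp (Q.concat q (r.cons a) y)))
      (fun t m => ?_)) z
    simp only [LinearMap.comp_apply]
    rw [concat_snoc, concat_snoc]
    refine (Q.extend_incl a m _ _).symm.trans ?_
    rw [ih, extend_incl]
    exact congrArg (Q.incl ((p.comp (q.comp r)).cons a))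
      (Q.concat_snoc p (q.comp r) a x (Q.concat q r y t) m).symm

theorem comp_assoc {i j k l : Q.V} (x : Q.PathSum i j) (y : Q.PathSum j k) (z : Q.PathSum k l) :
    Q.comp i k l (Q.comp i j k x y) z = Q.comp i j l x (Q.comp j k l y z) := by
  have h1 : ∀ (p : Quiver.Path i j) (x : Q.TensorPath p) (q : Quiver.Path j k)
      (y : Q.TensorPath q), Q.comp i k l (Q.comp i j k (Q.incl p x) (Q.incl q y)) z =
        Q.comp i j l (Q.incl p x) (Q.comp j k l (Q.incl q y) z) := fun p x q y => by
    have : Q.comp i k l (Q.comp i j k (Q.incl p x) (Q.incl q y)) =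
        (Q.comp i j l (Q.incl p x)).comp (Q.comp j k l (Q.incl q y)) :=
      Q.pathSum_hom_ext (fun r z => by
        simp only [LinearMap.comp_apply, comp_incl, concat_assoc])
    exact LinearMap.congr_fun this z
  have h2 : ∀ (p : Quiver.Path i j) (x : Q.TensorPath p),
      Q.comp i k l (Q.comp i j k (Q.incl p x) y) z =
        Q.comp i j l (Q.incl p x) (Q.comp j k l y z) := fun p x => by
    have : ((Q.comp i k l).flip z).comp (Q.comp i j k (Q.incl p x)) =
        (Q.comp i j l (Q.incl p x)).comp ((Q.comp j k l).flip z) :=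
      Q.pathSum_hom_ext (fun q y => h1 p x q y)
    exact LinearMap.congr_fun this y
  have : ((Q.comp i k l).flip z).comp ((Q.comp i j k).flip y) =
      (Q.comp i j l).flip (Q.comp j k l y z) :=
    Q.pathSum_hom_ext (fun p x => h2 p x)
  exact LinearMap.congr_fun this x

/-- The tensor algebra of a modulated quiver: the direct sum of all tensor paths, including those
of length zero. An element is recorded as the family of its components in the direct sums of the
tensor paths from `i` to `j`, for the (finitely many) pairs of vertices `i, j`. -/
def TensorAlgebra : Type (max v w) := ∀ i j : Q.V, Q.PathSum i j

namespace TensorAlgebra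

noncomputable instance : AddCommGroup Q.TensorAlgebra :=
  inferInstanceAs (AddCommGroup (∀ i j : Q.V, Q.PathSum i j))

noncomputable instance : Module K Q.TensorAlgebra :=
  inferInstanceAs (Module K (∀ i j : Q.V, Q.PathSum i j))

/-- The multiplication is the concatenation of paths. -/
noncomputable instance : Mul Q.TensorAlgebra :=
  ⟨fun x y i k => ∑ j : Q.V, Q.comp i j k (x i j) (y j k)⟩

open Classical in
noncomputable instance : One Q.TensorAlgebra :=
  ⟨fun i j => if h : i = j then h ▸ Q.idPath i else 0⟩

variable {Q}

@[ext] theorem ext {x y : Q.TensorAlgebra} (h : ∀ i j, x i j = y i j) : x = y :=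
  funext fun i => funext fun j => h i j

theorem mul_apply (x y : Q.TensorAlgebra) (i k : Q.V) :
    (x * y) i k = ∑ j : Q.V, Q.comp i j k (x i j) (y j k) := rfl

theorem add_apply (x y : Q.TensorAlgebra) (i k : Q.V) : (x + y) i k = x i k + y i k := rfl

theorem smul_apply (c : K) (x : Q.TensorAlgebra) (i k : Q.V) : (c • x) i k = c • x i k := rfl

theorem zero_apply (i k : Q.V) : (0 : Q.TensorAlgebra) i k = 0 := rfl

theorem one_apply_same (i : Q.V) : (1 : Q.TensorAlgebra) i i = Q.idPath i := by
  classical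
  exact dif_pos rfl

theorem one_apply_ne {i j : Q.V} (h : i ≠ j) : (1 : Q.TensorAlgebra) i j = 0 := by
  classical
  exact dif_neg h

noncomputable instance : Ring Q.TensorAlgebra where
  __ := (inferInstance : AddCommGroup Q.TensorAlgebra)
  mul := (· * ·)
  one := 1
  left_distrib x y z := by
    ext i k
    simp [mul_apply, add_apply, Finset.sum_add_distrib]
  right_distrib x y z := by
    ext i k
    simp [mul_apply, add_apply, Finset.sum_add_distrib]
  zero_mul x := by
    ext i k
    simp [mul_apply, zero_apply]
  mul_zero x := by
    ext i k
    simp [mul_apply, zero_apply]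
  mul_assoc x y z := by
    ext i l
    simp only [mul_apply, map_sum, LinearMap.sum_apply, comp_assoc]
    rw [Finset.sum_comm]
  one_mul x := by
    ext i k
    rw [mul_apply, Finset.sum_eq_single i (fun j _ hj => by rw [one_apply_ne hj.symm]; simp)
      (fun h => absurd (Finset.mem_univ i) h), one_apply_same, id_comp]
  mul_one x := by
    ext i k
    rw [mul_apply, Finset.sum_eq_single k (fun j _ hj => by rw [one_apply_ne hj]; simp)
      (fun h => absurd (Finset.mem_univ k) h), one_apply_same, comp_id]

noncomputable instance : Algebra K Q.TensorAlgebra :=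
  Algebra.ofModule
    (fun c x y => by ext i k; simp [mul_apply, smul_apply, Finset.smul_sum])
    (fun c x y => by ext i k; simp [mul_apply, smul_apply, Finset.smul_sum])

end TensorAlgebra

end ModulatedQuiver

/-! ## Projective covers and hereditary algebras -/

section Rings

variable {R : Type v} [Ring R]

/-- A ring is right hereditary if all its right ideals (that is, the left ideals of the opposite
ring) are projective right modules. For finite dimensional algebras this is the same as being left
hereditary. -/
def IsRightHereditary (A : Type v) [Ring A] : Prop :=
  ∀ I : Ideal Aᵐᵒᵖ, Module.Projective Aᵐᵒᵖ I

/-- `π : P → S` is a projective cover: `P` is projective, `π` is surjective, and the kernel of `π`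
is superfluous. -/
structure IsProjectiveCover {P S : Type*} [AddCommGroup P] [Module R P] [AddCommGroup S]
    [Module R S] (π : P →ₗ[R] S) : Prop where
  projective : Module.Projective R P
  surjective : Function.Surjective π
  superfluous : ∀ N : Submodule R P, N ⊔ LinearMap.ker π = ⊤ → N = ⊤

namespace IsProjectiveCover

variable {P S : Type*} [AddCommGroup P] [Module R P] [AddCommGroup S] [Module R S]
  [IsSimpleModule R S] {π : P →ₗ[R] S}

theorem eq_top_of_not_le (h : IsProjectiveCover π) {N : Submodule R P}
    (hN : ¬ N ≤ LinearMap.ker π) : N = ⊤ := by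
  apply h.superfluous
  have h1 : N.map π = ⊤ := (eq_bot_or_eq_top (N.map π)).resolve_left (fun h0 =>
    hN (LinearMap.le_ker_iff_map.2 h0))
  rw [← Submodule.comap_map_eq, h1, Submodule.comap_top]

theorem exists_surjective (h : IsProjectiveCover π) : ∃ g : R →ₗ[R] P, Function.Surjective g := by
  have := IsSimpleModule.nontrivial R S
  obtain ⟨s, hs⟩ := exists_ne (0 : S)
  obtain ⟨g, hg⟩ := Module.projective_lifting_property π (LinearMap.toSpanSingleton R S s)
    h.surjective
  refine ⟨g, LinearMap.range_eq_top.1 (h.eq_top_of_not_le fun hle => hs ?_)⟩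
  have h1 : π (g 1) = s := by rw [← LinearMap.comp_apply, hg]; simp
  rw [← h1]
  exact hle ⟨1, rfl⟩

/-- A submodule of the projective cover of a simple module over a ring whose left ideals are
projective is projective. -/
theorem projective_submodule (h : IsProjectiveCover π)
    (hR : ∀ I : Ideal R, Module.Projective R I) (N : Submodule R P) : Module.Projective R N := by
  have := h.projective
  obtain ⟨g, hg⟩ := h.exists_surjective
  obtain ⟨i, hi⟩ := Module.projective_lifting_property g LinearMap.id hg
  have hinj : Function.Injective i := fun x y hxy => by
    have := congrArg g hxy
    rwa [← LinearMap.comp_apply, ← LinearMap.comp_apply, hi] at this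
  have := hR (N.map i)
  exact Module.Projective.of_equiv (Submodule.equivMapOfInjective i hinj N).symm

theorem injective_of_ne_zero (h : IsProjectiveCover π)
    {P' S' : Type*} [AddCommGroup P'] [Module R P'] [AddCommGroup S'] [Module R S']
    [IsSimpleModule R S'] {π' : P' →ₗ[R] S'} (h' : IsProjectiveCover π')
    (hR : ∀ I : Ideal R, Module.Projective R I) (f : P →ₗ[R] P') (hf : f ≠ 0) :
    Function.Injective f := by
  have := h'.projective_submodule hR (LinearMap.range f)
  obtain ⟨s, hs⟩ := Module.projective_lifting_property f.rangeRestrict LinearMap.id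
    f.surjective_rangeRestrict
  have hs' : ∀ y, f.rangeRestrict (s y) = y := fun y => LinearMap.congr_fun hs y
  have hker : ¬ LinearMap.range s ≤ LinearMap.ker π := by
    intro hle
    apply hf
    rw [← LinearMap.ker_eq_top]
    apply h.superfluous
    rw [eq_top_iff]
    rintro x -
    have : x = (x - s (f.rangeRestrict x)) + s (f.rangeRestrict x) := by abel
    rw [this]
    refine Submodule.add_mem_sup ?_ (hle ⟨_, rfl⟩)
    have h2 : f.rangeRestrict (x - s (f.rangeRestrict x)) = 0 := by rw [map_sub, hs', sub_self]
    simpa using congrArg Subtype.val h2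
  have hsurj : Function.Surjective s := LinearMap.range_eq_top.1 (h.eq_top_of_not_le hker)
  intro x y hxy
  obtain ⟨x, rfl⟩ := hsurj x
  obtain ⟨y, rfl⟩ := hsurj y
  have : f.rangeRestrict (s x) = f.rangeRestrict (s y) := Subtype.ext hxy
  rw [hs', hs'] at this
  rw [this]

theorem finite (K : Type u) [Field K] [Algebra K R] [Module.Finite K R] [Module K P]
    [IsScalarTower K R P] (h : IsProjectiveCover π) : Module.Finite K P := by
  obtain ⟨g, hg⟩ := h.exists_surjective
  exact Module.Finite.of_surjective (g.restrictScalars K) hg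

theorem isUnit_or_eq_zero (K : Type u) [Field K] [Algebra K R] [Module.Finite K R] [Module K P]
    [IsScalarTower K R P] (h : IsProjectiveCover π)
    (hR : ∀ I : Ideal R, Module.Projective R I) (f : Module.End R P) : IsUnit f ∨ f = 0 := by
  by_cases hf : f = 0
  · exact Or.inr hf
  refine Or.inl ((Module.End.isUnit_iff f).2 ?_)
  have := h.finite K
  have hi := h.injective_of_ne_zero h hR f hf
  exact ⟨hi, (LinearMap.injective_iff_surjective (f := f.restrictScalars K)).1 hi⟩

theorem nontrivial (h : IsProjectiveCover π) : Nontrivial P :=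
  have := IsSimpleModule.nontrivial R S
  h.surjective.nontrivial

theorem ker_le_ker_comp (h : IsProjectiveCover π) (f : Module.End R P) :
    LinearMap.ker π ≤ LinearMap.ker (π.comp f) := by
  by_cases hle : LinearMap.ker (π.comp f) ≤ LinearMap.ker π
  · by_cases h0 : π.comp f = 0
    · rw [h0, LinearMap.ker_zero]; exact le_top
    · have hc : IsCoatom (LinearMap.ker (π.comp f)) := LinearMap.isCoatom_ker_of_surjective
        (LinearMap.surjective_of_ne_zero h0)
      refine ((hc.le_iff.1 hle).resolve_left fun ht => ?_).le
      have := IsSimpleModule.nontrivial R S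
      obtain ⟨s, hs⟩ := exists_ne (0 : S)
      obtain ⟨x, rfl⟩ := h.surjective s
      exact hs (LinearMap.mem_ker.1 (ht ▸ Submodule.mem_top))
  · rw [h.eq_top_of_not_le hle]; exact le_top

/-- The endomorphism rings of a simple module `S` and of its projective cover `π : P → S` are
identified, through `π ∘ f = e f ∘ π`. -/
theorem exists_endEquiv (K : Type u) [Field K] [Algebra K R] [Module.Finite K R] [Module K P]
    [IsScalarTower K R P] (h : IsProjectiveCover π) (hR : ∀ I : Ideal R, Module.Projective R I) :
    ∃ e : Module.End R P ≃+* Module.End R S, ∀ f x, π (f x) = e f (π x) := by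
  have hex : ∀ f : Module.End R P, ∃ g : Module.End R S, ∀ x, π (f x) = g (π x) := fun f => by
    choose s hs using h.surjective
    have key : ∀ x y, π x = π y → π (f x) = π (f y) := fun x y hxy => by
      have : x - y ∈ LinearMap.ker (π.comp f) := h.ker_le_ker_comp f (by simp [hxy])
      simpa [sub_eq_zero] using this
    refine ⟨{ toFun := fun y => π (f (s y)), map_add' := fun y y' => ?_,
              map_smul' := fun r y => ?_ }, fun x => key _ _ (hs _).symm⟩
    · rw [← map_add, ← map_add]
      exact key _ _ (by simp [hs])
    · rw [RingHom.id_apply, ← map_smul, ← map_smul]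
      exact key _ _ (by simp [hs])
  choose e he using hex
  have huniq : ∀ (g g' : Module.End R S), (∀ x, g (π x) = g' (π x)) → g = g' := fun g g' hg =>
    LinearMap.ext fun y => by obtain ⟨x, rfl⟩ := h.surjective y; exact hg x
  let E : Module.End R P →+* Module.End R S :=
    { toFun := e
      map_one' := huniq _ _ fun x => by simp [← he]
      map_mul' := fun f g => huniq _ _ fun x => by simp [← he]
      map_zero' := huniq _ _ fun x => by simp [← he]
      map_add' := fun f g => huniq _ _ fun x => by simp [← he] }
  refine ⟨RingEquiv.ofBijective E ⟨?_, fun g => ?_⟩, he⟩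
  · rw [injective_iff_map_eq_zero]
    intro f hf
    refine (h.isUnit_or_eq_zero K hR f).resolve_left fun hu => ?_
    obtain ⟨hb, hsurj⟩ := (Module.End.isUnit_iff f).1 hu
    have := IsSimpleModule.nontrivial R S
    obtain ⟨s, hs⟩ := exists_ne (0 : S)
    obtain ⟨x, rfl⟩ := h.surjective s
    obtain ⟨y, rfl⟩ := hsurj x
    apply hs
    rw [he]
    exact LinearMap.congr_fun hf (π y)
  · have := h.projective
    obtain ⟨f, hf⟩ := Module.projective_lifting_property π (g.comp π) h.surjective
    exact ⟨f, huniq _ _ fun x => (he f x).symm.trans (LinearMap.congr_fun hf x)⟩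

end IsProjectiveCover

end Rings

/-! ## The radical of a module and the bimodules attached to projective modules -/

section Radical

variable (R : Type v) [Ring R] (P Q : Type v) [AddCommGroup P] [Module R P] [AddCommGroup Q]
  [Module R Q]

/-- The radical `rP` of a module. -/
abbrev Rad : Type v := Module.jacobson R P

/-- The quotient `rP / r²P`. -/
abbrev RadTop : Type v := Rad R P ⧸ Module.jacobson R (Rad R P)

variable {R P}

/-- The restriction of an endomorphism of `P` to `rP`. -/
def radMap (f : Module.End R P) : Module.End R (Rad R P) :=
  f.restrict (fun _ hx => Module.le_comap_jacobson f hx)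

/-- The endomorphism of `rP / r²P` induced by an endomorphism of `P`. -/
def radTopMap (f : Module.End R P) : Module.End R (RadTop R P) :=
  Submodule.mapQ _ _ (radMap f) (Module.le_comap_jacobson (radMap f))

theorem radTopMap_one : radTopMap (1 : Module.End R P) = 1 := Submodule.linearMap_qext _ rfl

theorem radTopMap_mul (f g : Module.End R P) : radTopMap (f * g) = radTopMap f * radTopMap g :=
  Submodule.linearMap_qext _ rfl

theorem radTopMap_zero : radTopMap (0 : Module.End R P) = 0 := Submodule.linearMap_qext _ rfl

theorem radTopMap_add (f g : Module.End R P) : radTopMap (f + g) = radTopMap f + radTopMap g :=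
  Submodule.linearMap_qext _ rfl

variable (R P)

/-- `Hom_R(Q, rP)`. -/
def RadHom : Type v := Q →ₗ[R] Rad R P

/-- `Hom_R(Q, rP / r²P)`. -/
def RadTopHom : Type v := Q →ₗ[R] RadTop R P

variable {R P Q}

namespace RadHom

instance : AddCommGroup (RadHom R P Q) := inferInstanceAs (AddCommGroup (Q →ₗ[R] Rad R P))

/-- The left action of `End(P)` by composition. -/
instance : Module (Module.End R P) (RadHom R P Q) where
  smul f φ := (radMap f).comp (φ : Q →ₗ[R] Rad R P)
  one_smul _ := rfl
  mul_smul _ _ _ := rfl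
  smul_zero f := LinearMap.comp_zero (radMap f)
  smul_add f φ ψ := LinearMap.comp_add (φ : Q →ₗ[R] Rad R P) ψ (radMap f)
  add_smul _ _ _ := rfl
  zero_smul _ := rfl

/-- The right action of `End(Q)` by composition. -/
instance : Module (Module.End R Q)ᵐᵒᵖ (RadHom R P Q) where
  smul g φ := (φ : Q →ₗ[R] Rad R P).comp g.unop
  one_smul _ := rfl
  mul_smul _ _ _ := rfl
  smul_zero _ := rfl
  smul_add _ _ _ := rfl
  add_smul g h φ := LinearMap.comp_add g.unop h.unop (φ : Q →ₗ[R] Rad R P)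
  zero_smul φ := LinearMap.comp_zero (φ : Q →ₗ[R] Rad R P)

end RadHom

namespace RadTopHom

instance : AddCommGroup (RadTopHom R P Q) :=
  inferInstanceAs (AddCommGroup (Q →ₗ[R] RadTop R P))

/-- The left action of `End(P)` by composition. -/
instance : Module (Module.End R P) (RadTopHom R P Q) where
  smul f φ := (radTopMap f).comp (φ : Q →ₗ[R] RadTop R P)
  one_smul φ := congrArg (fun u => LinearMap.comp u (φ : Q →ₗ[R] RadTop R P)) radTopMap_one
  mul_smul f g φ :=
    congrArg (fun u => LinearMap.comp u (φ : Q →ₗ[R] RadTop R P)) (radTopMap_mul f g)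
  smul_zero f := LinearMap.comp_zero (radTopMap f)
  smul_add f φ ψ := LinearMap.comp_add (φ : Q →ₗ[R] RadTop R P) ψ (radTopMap f)
  add_smul f g φ :=
    congrArg (fun u => LinearMap.comp u (φ : Q →ₗ[R] RadTop R P)) (radTopMap_add f g)
  zero_smul φ := congrArg (fun u => LinearMap.comp u (φ : Q →ₗ[R] RadTop R P)) radTopMap_zero

/-- The right action of `End(Q)` by composition. -/
instance : Module (Module.End R Q)ᵐᵒᵖ (RadTopHom R P Q) where
  smul g φ := (φ : Q →ₗ[R] RadTop R P).comp g.unop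
  one_smul _ := rfl
  mul_smul _ _ _ := rfl
  smul_zero _ := rfl
  smul_add _ _ _ := rfl
  add_smul g h φ := LinearMap.comp_add g.unop h.unop (φ : Q →ₗ[R] RadTop R P)
  zero_smul φ := LinearMap.comp_zero (φ : Q →ₗ[R] RadTop R P)

instance : SMulCommClass (Module.End R P) (Module.End R Q)ᵐᵒᵖ (RadTopHom R P Q) :=
  ⟨fun _ _ _ => rfl⟩

variable {K : Type u} [Field K] [Algebra K R] [Module K P] [IsScalarTower K R P]
  [Module K Q] [IsScalarTower K R Q]

instance : Module K (RadTopHom R P Q) :=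
  inferInstanceAs (Module K (Q →ₗ[R] RadTop R P))

instance : IsScalarTower K (Module.End R P) (RadTopHom R P Q) :=
  ⟨fun c f φ =>
    have h : radTopMap (c • f) = c • radTopMap f := Submodule.linearMap_qext _ rfl
    congrArg (fun u => LinearMap.comp u (φ : Q →ₗ[R] RadTop R P)) h⟩

instance : IsScalarTower K (Module.End R Q)ᵐᵒᵖ (RadTopHom R P Q) :=
  ⟨fun c g φ =>
    have h : ∀ ψ : Q →ₗ[R] RadTop R P, ψ.comp (c • g.unop) = c • ψ.comp g.unop := fun ψ =>
      LinearMap.ext fun q => (ψ.restrictScalars K).map_smul c (g.unop q)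
    h φ⟩

theorem finite [Module.Finite K P] [Module.Finite K Q] : Module.Finite K (RadTopHom R P Q) := by
  have h1 : Module.Finite K (Rad R P) :=
    inferInstanceAs (Module.Finite K ((Module.jacobson R P).restrictScalars K))
  have h2 : Module.Finite K (RadTop R P) := Module.Finite.quotient K _
  have h3 : Module.Finite K (Q →ₗ[K] RadTop R P) := inferInstance
  have h4 : Module.Finite K (Q →ₗ[R] RadTop R P) := Module.Finite.of_injective
    (LinearMap.restrictScalarsₗ K R Q (RadTop R P) K) (LinearMap.restrictScalars_injective K)
  exact h4

end RadTopHom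

/-- Homomorphisms of `F`-`G`-bimodules. -/
structure BimoduleHom (F G M N : Type*) [Ring F] [Ring G] [AddCommGroup M] [AddCommGroup N]
    [Module F M] [Module Gᵐᵒᵖ M] [Module F N] [Module Gᵐᵒᵖ N] extends M →+ N where
  map_left_smul : ∀ (f : F) (m : M), toFun (f • m) = f • toFun m
  map_right_smul : ∀ (g : Gᵐᵒᵖ) (m : M), toFun (g • m) = g • toFun m

/-- A bimodule homomorphism has a section if it has a right inverse that is a homomorphism of
bimodules. -/
def BimoduleHom.HasSection {F G M N : Type*} [Ring F] [Ring G] [AddCommGroup M] [AddCommGroup N]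
    [Module F M] [Module Gᵐᵒᵖ M] [Module F N] [Module Gᵐᵒᵖ N] (p : BimoduleHom F G M N) : Prop :=
  ∃ σ : BimoduleHom F G N M, ∀ n, p.toAddMonoidHom (σ.toAddMonoidHom n) = n

variable (R P Q)

/-- The homomorphism `Hom_R(Q, rP) → Hom_R(Q, rP / r²P)` of `End(P)`-`End(Q)`-bimodules given by
the projection `rP → rP / r²P`. -/
def radHomProj :
    BimoduleHom (Module.End R P) (Module.End R Q) (RadHom R P Q) (RadTopHom R P Q) where
  toFun φ := (Module.jacobson R (Rad R P)).mkQ.comp (φ : Q →ₗ[R] Rad R P)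
  map_zero' := LinearMap.comp_zero _
  map_add' φ ψ := LinearMap.comp_add (φ : Q →ₗ[R] Rad R P) ψ _
  map_left_smul _ _ := rfl
  map_right_smul _ _ := rfl

theorem radHomProj_surjective [Module.Projective R Q] :
    Function.Surjective (radHomProj R P Q).toAddMonoidHom := fun φ =>
  Module.projective_lifting_property _ (φ : Q →ₗ[R] RadTop R P) (Submodule.mkQ_surjective _)

end Radical

/-! ## The modulated quiver of a hereditary algebra -/

/-- A complete list `S i` (`i ∈ ι`, finite) of the simple right modules over a `K`-algebra `Λ`, up
to isomorphism and without repetition, with a projective cover `π i : P i → S i` of each. The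
`K`-vector space structure on `P i` is the one that comes from `Λ`. -/
structure SimpleSystem (K : Type u) [Field K] (Λ : Type v) [Ring Λ] [Algebra K Λ]
    (ι : Type w) where
  S : ι → Type v
  [addCommGroupS : ∀ i, AddCommGroup (S i)]
  [moduleS : ∀ i, Module Λᵐᵒᵖ (S i)]
  [simpleS : ∀ i, IsSimpleModule Λᵐᵒᵖ (S i)]
  eq_of_iso : ∀ i j, Nonempty (S i ≃ₗ[Λᵐᵒᵖ] S j) → i = j
  exists_iso : ∀ (X : Type v) [AddCommGroup X] [Module Λᵐᵒᵖ X] [IsSimpleModule Λᵐᵒᵖ X],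
    ∃ i, Nonempty (X ≃ₗ[Λᵐᵒᵖ] S i)
  P : ι → Type v
  [addCommGroupP : ∀ i, AddCommGroup (P i)]
  [moduleP : ∀ i, Module Λᵐᵒᵖ (P i)]
  [moduleKP : ∀ i, Module K (P i)]
  [towerP : ∀ i, IsScalarTower K Λᵐᵒᵖ (P i)]
  π : ∀ i, P i →ₗ[Λᵐᵒᵖ] S i
  cover : ∀ i, IsProjectiveCover (π i)

namespace SimpleSystem

attribute [instance] addCommGroupS moduleS simpleS addCommGroupP moduleP moduleKP towerP

variable {K : Type u} [Field K] {Λ : Type v} [Ring Λ] [Algebra K Λ] {ι : Type w}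
  (D : SimpleSystem K Λ ι)

/-- There is an arrow `i → j` if `Ext¹(S i, S j) ≠ 0`. -/
def Arrow (i j : ι) : Prop :=
  Nontrivial (Abelian.Ext (ModuleCat.of Λᵐᵒᵖ (D.S i)) (ModuleCat.of Λᵐᵒᵖ (D.S j)) 1)

theorem exists_of_arrow {i j : ι} (h : D.Arrow i j) :
    ∃ φ : LinearMap.ker (D.π i) →ₗ[Λᵐᵒᵖ] D.S j, φ ≠ 0 := by
  by_contra! hall
  have hproj := (D.cover i).projective
  let C : ShortComplex (ModuleCat.{v} Λᵐᵒᵖ) := ShortComplex.mk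
    (ModuleCat.ofHom (LinearMap.ker (D.π i)).subtype) (ModuleCat.ofHom (D.π i)) (by
      ext x; exact x.2)
  have hC : C.ShortExact := by
    refine ShortComplex.ShortExact.mk' ?_ ?_ ?_
    · rw [ShortComplex.moduleCat_exact_iff]
      intro x hx
      exact ⟨⟨x, hx⟩, rfl⟩
    · exact (ModuleCat.mono_iff_injective _).2 Subtype.val_injective
    · exact (ModuleCat.epi_iff_surjective _).2 (D.cover i).surjective
  have : Projective C.X₂ := by
    have : Module.Projective Λᵐᵒᵖ C.X₂ := hproj
    exact (IsProjective.iff_projective _ ).1 this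
  obtain ⟨x, hx⟩ := @exists_ne _ h 0
  apply hx
  obtain ⟨y, hy⟩ := Abelian.Ext.contravariant_sequence_exact₃ hC
    (ModuleCat.of Λᵐᵒᵖ (D.S j)) x (Abelian.Ext.eq_zero_of_projective _) (add_comm 1 0)
  obtain ⟨f, rfl⟩ := (Abelian.Ext.mk₀_bijective _ _).2 y
  have hf : f = 0 := ModuleCat.hom_ext (hall f.hom)
  rw [← hy, hf, Abelian.Ext.mk₀_zero, Abelian.Ext.comp_zero]

variable [Module.Finite K Λ]

theorem finrank_lt_of_arrow (hΛ : IsRightHereditary Λ) {i j : ι} (h : D.Arrow i j) :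
    Module.finrank K (D.P j) < Module.finrank K (D.P i) := by
  have : Module.Finite K Λᵐᵒᵖ := Module.Finite.equiv (MulOpposite.opLinearEquiv K)
  have := (D.cover i).finite K
  have := (D.cover j).projective
  obtain ⟨φ, hφ⟩ := D.exists_of_arrow h
  have hs : Function.Surjective φ := LinearMap.surjective_of_ne_zero hφ
  obtain ⟨g, hg⟩ := Module.projective_lifting_property φ (D.π j) hs
  have hg0 : (LinearMap.ker (D.π i)).subtype.comp g ≠ 0 := by
    intro h0
    have hz : g = 0 := LinearMap.ext fun x => Subtype.ext (LinearMap.congr_fun h0 x)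
    have hπ : D.π j = 0 := by rw [← hg, hz, LinearMap.comp_zero]
    have := IsSimpleModule.nontrivial Λᵐᵒᵖ (D.S j)
    obtain ⟨s, hs⟩ := exists_ne (0 : D.S j)
    obtain ⟨x, rfl⟩ := (D.cover j).surjective s
    exact hs (by rw [hπ]; rfl)
  have hinj := (D.cover j).injective_of_ne_zero (D.cover i) hΛ _ hg0
  let q : D.P j →ₗ[K] D.P i :=
    ((LinearMap.ker (D.π i)).subtype.comp g).restrictScalars K
  rw [← LinearMap.finrank_range_of_inj (f := q) hinj]
  refine Submodule.finrank_lt fun htop => ?_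
  have := IsSimpleModule.nontrivial Λᵐᵒᵖ (D.S i)
  obtain ⟨s, hs⟩ := exists_ne (0 : D.S i)
  obtain ⟨x, rfl⟩ := (D.cover i).surjective s
  obtain ⟨y, rfl⟩ := LinearMap.range_eq_top.1 htop x
  exact hs (g y).2

theorem acyclic (hΛ : IsRightHereditary Λ) (i : ι) : ¬ Relation.TransGen D.Arrow i i := by
  have key : ∀ i j, Relation.TransGen D.Arrow i j →
      Module.finrank K (D.P j) < Module.finrank K (D.P i) := by
    intro i j h
    induction h with
    | single h => exact D.finrank_lt_of_arrow hΛ h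
    | tail _ h ih => exact (D.finrank_lt_of_arrow hΛ h).trans ih
  exact fun h => lt_irrefl _ (key i i h)

/-- `F i = End(P i)`, a division algebra over `K` since `Λ` is hereditary. -/
noncomputable abbrev divisionRing (hΛ : IsRightHereditary Λ) (i : ι) :
    DivisionRing (Module.End Λᵐᵒᵖ (D.P i)) :=
  have : Module.Finite K Λᵐᵒᵖ := Module.Finite.equiv (MulOpposite.opLinearEquiv K)
  have := (D.cover i).nontrivial
  DivisionRing.ofIsUnitOrEqZero ((D.cover i).isUnit_or_eq_zero K hΛ)

/-- The modulated quiver of a finite dimensional hereditary algebra: there is an arrow `i → j` if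
`Ext¹(S i, S j) ≠ 0`, `F i = End(P i)` (which is identified with `End(S i)`), and `M i j` is the
`F i`-`F j`-bimodule `Hom(P j, rP i / r²P i)`. -/
noncomputable def modulatedQuiver [Fintype ι] (hΛ : IsRightHereditary Λ) :
    ModulatedQuiver.{u, v, w} K :=
  have : Module.Finite K Λᵐᵒᵖ := Module.Finite.equiv (MulOpposite.opLinearEquiv K)
  have : ∀ i, Module.Finite K (D.P i) := fun i => (D.cover i).finite K
  { V := ι
    Arrow := D.Arrow
    acyclic := D.acyclic hΛ
    F := fun i => Module.End Λᵐᵒᵖ (D.P i)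
    divisionRingF := D.divisionRing hΛ
    algebraF := fun i => inferInstanceAs (Algebra K (Module.End Λᵐᵒᵖ (D.P i)))
    finiteF := fun i => Module.Finite.of_injective
      (LinearMap.restrictScalarsₗ K Λᵐᵒᵖ (D.P i) (D.P i) K) (LinearMap.restrictScalars_injective K)
    M := fun i j _ => RadTopHom Λᵐᵒᵖ (D.P i) (D.P j)
    addCommGroupM := fun _ _ _ => inferInstance
    moduleM := fun _ _ _ => inferInstance
    leftModuleM := fun i j _ =>
      inferInstanceAs (Module (Module.End Λᵐᵒᵖ (D.P i)) (RadTopHom Λᵐᵒᵖ (D.P i) (D.P j)))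
    rightModuleM := fun i j _ =>
      inferInstanceAs (Module (Module.End Λᵐᵒᵖ (D.P j))ᵐᵒᵖ (RadTopHom Λᵐᵒᵖ (D.P i) (D.P j)))
    bimoduleM := fun i j _ => inferInstanceAs (SMulCommClass (Module.End Λᵐᵒᵖ (D.P i))
      (Module.End Λᵐᵒᵖ (D.P j))ᵐᵒᵖ (RadTopHom Λᵐᵒᵖ (D.P i) (D.P j)))
    leftTowerM := fun i j _ => inferInstanceAs (IsScalarTower K (Module.End Λᵐᵒᵖ (D.P i))
      (RadTopHom Λᵐᵒᵖ (D.P i) (D.P j)))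
    rightTowerM := fun i j _ => inferInstanceAs (IsScalarTower K
      (Module.End Λᵐᵒᵖ (D.P j))ᵐᵒᵖ (RadTopHom Λᵐᵒᵖ (D.P i) (D.P j)))
    finiteM := fun _ _ _ => RadTopHom.finite }

end SimpleSystem

/-! Both directions reduce to the homomorphisms between the `P i`. The modules `P i` generate, so
`Λ` is Morita equivalent to the endomorphism algebra of their direct sum. Since `Λ` is hereditary, a
nonzero map between two of the `P i` is injective; hence the `End(P i)` are division algebras and
the quiver is acyclic.

From sections to an equivalence: a bimodule section turns each `M i j` into honest maps `P j → rP
i`, so tensor paths act by composition, and this gives an algebra homomorphism from the tensor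
algebra to the endomorphisms of the sum of the `P i` (`Realization.toEnd`). Lift an `F j`-basis of
every `M i j` in this way. The resulting map from a direct sum of modules `P j` to `rP i` is
surjective by a Nakayama argument (`radSum_surjective`), and injective because `rP i` is projective
and the map is independent modulo `r²P i` (`radSum_injective`). Thus a map `P k → P i` with `k ≠ i`
has unique coordinates with respect to the lifted basis, and induction on the dimension of `P i`
shows that tensor paths realize all homomorphisms exactly once (`realization_eval_bijective`). The
theorem on progenerators (`isMoritaEquivalent_of_progenerator`) finishes.

From an equivalence to sections: the regular module over the tensor algebra corresponds to a
projective generator `Z` whose endomorphism ring is the tensor algebra. By acyclicity the corner at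
a vertex is a division algebra, so the vertex idempotents are primitive, and each `P i` is the
summand of `Z` cut out by one of them (`exists_vertex`). Hence `Hom(P j, P i)` becomes a path sum,
compatibly with composition (`exists_hom_equiv`). For `i ≠ j`, paths of length at least two
correspond to the maps into `r²P i`. The projection onto paths of length one commutes with both
actions, kills these maps and is the identity modulo them; this is a section
(`hasSection_of_hom_equiv`). The matching of vertices may be any bijection; it need not be the
identity. -/

/-! ## Modules over the endomorphism ring of a progenerator -/

section Progenerator

universe u₀ u₁ u₂ u₃ u₄

variable {K : Type u₀} [CommRing K] {A : Type u₁} [Ring A] [Algebra K A] {B : Type u₂} [Ring B]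
  [Algebra K B] {P : Type u₃} [AddCommGroup P] [Module A P] [Module K P] [IsScalarTower K A P]

/-- `Hom_A(P, X)` as a module over an algebra `B` identified with `End_A(P)ᵐᵒᵖ`. -/
@[nolint unusedArguments]
def HomModule (_ : B ≃ₐ[K] (Module.End A P)ᵐᵒᵖ) (X : Type u₄) [AddCommGroup X] [Module A X] :
    Type (max u₃ u₄) := P →ₗ[A] X

namespace HomModule

variable (e : B ≃ₐ[K] (Module.End A P)ᵐᵒᵖ)

section Basic

variable {X : Type u₄} [AddCommGroup X] [Module A X]

instance : AddCommGroup (HomModule e X) := inferInstanceAs (AddCommGroup (P →ₗ[A] X))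

/-- The element of `HomModule e X` given by a linear map. -/
def of (f : P →ₗ[A] X) : HomModule e X := f

/-- The linear map underlying an element of `HomModule e X`. -/
def toHom : HomModule e X →+ (P →ₗ[A] X) := AddMonoidHom.id _

instance : Module B (HomModule e X) where
  smul b f := of e ((toHom e f).comp (e b).unop)
  one_smul f := by
    change of e ((toHom e f).comp (e 1).unop) = f
    rw [map_one]; rfl
  mul_smul b c f := by
    change of e ((toHom e f).comp (e (b * c)).unop) = _
    rw [map_mul]; rfl
  smul_zero b := LinearMap.zero_comp _
  smul_add b f g := LinearMap.add_comp _ _ _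
  add_smul b c f := by
    change of e ((toHom e f).comp (e (b + c)).unop) = _
    rw [map_add]; exact LinearMap.comp_add _ _ _
  zero_smul f := by
    change of e ((toHom e f).comp (e 0).unop) = _
    rw [map_zero]; exact LinearMap.comp_zero _

theorem toHom_smul (b : B) (f : HomModule e X) :
    toHom e (b • f) = (toHom e f).comp (e b).unop := rfl

theorem smul_of (b : B) (f : P →ₗ[A] X) : b • of e f = of e (f.comp (e b).unop) := rfl

/-- Postcomposition with a linear map. -/
def map {Y : Type*} [AddCommGroup Y] [Module A Y] (g : X →ₗ[A] Y) :
    HomModule e X →ₗ[B] HomModule e Y where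
  toFun f := of e (g.comp (toHom e f))
  map_add' _ _ := LinearMap.comp_add _ _ _
  map_smul' _ _ := rfl

end Basic

/-- The rank one endomorphism `q ↦ φ(q) p` of `P`. -/
def rankOne (p : P) (φ : P →ₗ[A] A) : Module.End A P := (LinearMap.toSpanSingleton A P p).comp φ

@[simp] theorem rankOne_apply (p : P) (φ : P →ₗ[A] A) (q : P) : rankOne p φ q = φ q • p := rfl

/-- The element of `B` that corresponds to `rankOne`. -/
def rankOneElt (p : P) (φ : P →ₗ[A] A) : B := e.symm (MulOpposite.op (rankOne p φ))

theorem unop_rankOneElt (p : P) (φ : P →ₗ[A] A) : (e (rankOneElt e p φ)).unop = rankOne p φ := by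
  simp [rankOneElt]

theorem eq_of_unop {b c : B} (h : (e b).unop = (e c).unop) : b = c :=
  e.injective (MulOpposite.unop_injective h)

section Trace

variable {α : Type*} [Fintype α] (f : α → P →ₗ[A] A) (p : α → P)
variable {X : Type u₄} [AddCommGroup X] [Module A X] {Y : Type*} [AddCommGroup Y] [Module A Y]

/-- If `∑ f a (p a) = 1`, a `B`-linear map `Hom(P, X) → Hom(P, Y)` comes from this map. -/
def descendFun (h : HomModule e X →ₗ[B] HomModule e Y) : X →+ Y where
  toFun x := ∑ a, toHom e (h (of e ((LinearMap.toSpanSingleton A X x).comp (f a)))) (p a)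
  map_zero' := by
    refine Finset.sum_eq_zero fun a _ => ?_
    rw [LinearMap.toSpanSingleton_zero, LinearMap.zero_comp]
    change toHom e (h 0) (p a) = 0
    simp
  map_add' x y := by
    rw [← Finset.sum_add_distrib]
    refine Finset.sum_congr rfl fun a _ => ?_
    have : of e ((LinearMap.toSpanSingleton A X (x + y)).comp (f a)) =
        of e ((LinearMap.toSpanSingleton A X x).comp (f a)) +
          of e ((LinearMap.toSpanSingleton A X y).comp (f a)) :=
      LinearMap.ext fun q => smul_add _ x y
    rw [this, map_add, map_add, LinearMap.add_apply]

variable {f p}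

/-- The map `r ↦ f a r • g q` is `g` composed with the rank one endomorphism of `q` and `f a`, so it
is a `B`-multiple of `g` and `h` can be pulled through it. Evaluating at `p a` leaves the
coefficient `f a (p a)`, and these sum to `1`. -/
theorem descendFun_apply (hfp : ∑ a, f a (p a) = 1) (h : HomModule e X →ₗ[B] HomModule e Y)
    (g : HomModule e X) (q : P) : descendFun e f p h (toHom e g q) = toHom e (h g) q := by
  have key : ∀ a, toHom e (h (of e ((LinearMap.toSpanSingleton A X (toHom e g q)).comp (f a))))
      (p a) = f a (p a) • toHom e (h g) q := fun a => by
    have : of e ((LinearMap.toSpanSingleton A X (toHom e g q)).comp (f a)) =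
        rankOneElt e q (f a) • g := LinearMap.ext fun r => by
      change f a r • toHom e g q = toHom e g ((e (rankOneElt e q (f a))).unop r)
      rw [unop_rankOneElt, rankOne_apply, map_smul]
    rw [this, map_smul, toHom_smul, unop_rankOneElt, LinearMap.comp_apply, rankOne_apply, map_smul]
  change ∑ a, _ = _
  rw [Finset.sum_congr rfl fun a _ => key a, ← Finset.sum_smul, hfp, one_smul]

theorem eq_sum_apply (hfp : ∑ a, f a (p a) = 1) (x : X) :
    x = ∑ a, (LinearMap.toSpanSingleton A X x).comp (f a) (p a) := by
  simp [← Finset.sum_smul, hfp]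

/-- The defining sum is not visibly linear over `A`, which is noncommutative. Writing `c • x` as a
sum of values at the points `c • p a` brings it under `descendFun_apply`, where linearity of the
maps out of `P` applies. -/
theorem descendFun_smul (hfp : ∑ a, f a (p a) = 1) (h : HomModule e X →ₗ[B] HomModule e Y)
    (c : A) (x : X) : descendFun e f p h (c • x) = c • descendFun e f p h x := by
  have key : ∀ c : A, descendFun e f p h (c • x) =
      c • ∑ a, toHom e (h (of e ((LinearMap.toSpanSingleton A X x).comp (f a)))) (p a) := by
    intro c
    have hx : c • x =
        ∑ a, toHom e (of e ((LinearMap.toSpanSingleton A X x).comp (f a))) (c • p a) := by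
      conv_lhs => rw [eq_sum_apply hfp x]
      rw [Finset.smul_sum]
      exact Finset.sum_congr rfl fun a _ => (map_smul _ c (p a)).symm
    rw [hx, map_sum, Finset.smul_sum]
    refine Finset.sum_congr rfl fun a _ => ?_
    rw [descendFun_apply e hfp, map_smul]
  exact key c

theorem exists_map_eq (hfp : ∑ a, f a (p a) = 1) (h : HomModule e X →ₗ[B] HomModule e Y) :
    ∃ g : X →ₗ[A] Y, map e g = h :=
  ⟨{ descendFun e f p h with map_smul' := descendFun_smul e hfp h },
    LinearMap.ext fun g => LinearMap.ext fun q => descendFun_apply e hfp h g q⟩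

theorem map_injective (hfp : ∑ a, f a (p a) = 1) {g g' : X →ₗ[A] Y} (h : map e g = map e g') :
    g = g' := by
  refine LinearMap.ext fun x => ?_
  rw [eq_sum_apply hfp x, map_sum, map_sum]
  refine Finset.sum_congr rfl fun a _ => ?_
  exact LinearMap.congr_fun
    (LinearMap.congr_fun h (of e ((LinearMap.toSpanSingleton A X x).comp (f a)))) (p a)

end Trace

end HomModule

open HomModule

variable (e : B ≃ₐ[K] (Module.End A P)ᵐᵒᵖ)

/-- The dual `Hom_A(P, A)` is a right `A`-module. -/
instance : SMul Aᵐᵒᵖ (HomModule e A) := ⟨fun a φ => of e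
  ((LinearMap.toSpanSingleton A A a.unop).comp (toHom e φ))⟩

/-- `Hom_B(Hom_A(P, A), N)`, as an `A`-module. -/
def CoinducedModule (N : Type u₄) [AddCommGroup N] [Module B N] : Type (max u₁ u₃ u₄) :=
  HomModule e A →ₗ[B] N

namespace CoinducedModule

variable {e} {N : Type u₄} [AddCommGroup N] [Module B N]

instance : AddCommGroup (CoinducedModule e N) :=
  inferInstanceAs (AddCommGroup (HomModule e A →ₗ[B] N))

instance : FunLike (CoinducedModule e N) (HomModule e A) N :=
  inferInstanceAs (FunLike (HomModule e A →ₗ[B] N) (HomModule e A) N)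

@[ext] theorem ext {h h' : CoinducedModule e N} (H : ∀ φ, h φ = h' φ) : h = h' :=
  LinearMap.ext H

instance : Module A (CoinducedModule e N) where
  smul a h :=
    { toFun := fun φ => h (MulOpposite.op a • φ)
      map_add' := fun φ ψ => by
        rw [show MulOpposite.op a • (φ + ψ) = MulOpposite.op a • φ + MulOpposite.op a • ψ from
          LinearMap.ext fun p => add_mul _ _ a]
        exact LinearMap.map_add _ _ _
      map_smul' := fun b φ => by
        rw [show MulOpposite.op a • (b • φ) = b • (MulOpposite.op a • φ) from rfl]
        exact LinearMap.map_smul _ _ _ }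
  one_smul h := ext fun φ => congrArg h (LinearMap.ext fun p => mul_one (toHom e φ p))
  mul_smul a b h := ext fun φ =>
    congrArg h (LinearMap.ext fun p => (mul_assoc (toHom e φ p) a b).symm)
  smul_zero _ := rfl
  smul_add _ _ _ := rfl
  add_smul a b h := ext fun φ => (congrArg h (LinearMap.ext fun p => mul_add (toHom e φ p) a b)).trans
    (LinearMap.map_add _ _ _)
  zero_smul h := ext fun φ => (congrArg h (LinearMap.ext fun p => mul_zero (toHom e φ p))).trans
    (LinearMap.map_zero _)

theorem smul_apply (a : A) (h : CoinducedModule e N) (φ : HomModule e A) :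
    (a • h) φ = h (MulOpposite.op a • φ) := rfl

end CoinducedModule

variable (N : Type u₄) [AddCommGroup N] [Module B N]

/-- The unit `N → Hom_A(P, Hom_B(Hom_A(P, A), N))`. -/
def coinducedUnit : N →ₗ[B] HomModule e (CoinducedModule e N) where
  toFun n := of e
    { toFun := fun p =>
        { toFun := fun φ => rankOneElt e p (toHom e φ) • n
          map_add' := fun φ ψ => by
            rw [← add_smul]
            congr 1
            apply eq_of_unop e
            rw [map_add e, MulOpposite.unop_add]
            simp only [unop_rankOneElt]
            exact LinearMap.ext fun q => add_smul (toHom e φ q) (toHom e ψ q) p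
          map_smul' := fun b φ => by
            rw [RingHom.id_apply, ← mul_smul]
            congr 1
            apply eq_of_unop e
            rw [map_mul, MulOpposite.unop_mul]
            simp only [unop_rankOneElt]
            rfl }
      map_add' := fun p q => LinearMap.ext fun φ => by
        change rankOneElt e (p + q) (toHom e φ) • n =
          rankOneElt e p (toHom e φ) • n + rankOneElt e q (toHom e φ) • n
        rw [← add_smul]
        congr 1
        apply eq_of_unop e
        rw [map_add e, MulOpposite.unop_add]
        simp only [unop_rankOneElt]
        exact LinearMap.ext fun r => smul_add (toHom e φ r) p q
      map_smul' := fun a p => LinearMap.ext fun φ => by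
        change rankOneElt e (a • p) (toHom e φ) • n =
          rankOneElt e p (toHom e (MulOpposite.op a • φ)) • n
        congr 1
        apply eq_of_unop e
        simp only [unop_rankOneElt]
        exact LinearMap.ext fun r => (mul_smul (toHom e φ r) a p).symm }
  map_add' n n' := LinearMap.ext fun p => LinearMap.ext fun φ => smul_add _ n n'
  map_smul' b n := LinearMap.ext fun p => LinearMap.ext fun φ => by
    change rankOneElt e p (toHom e φ) • (b • n) = rankOneElt e ((e b).unop p) (toHom e φ) • n
    rw [← mul_smul]
    congr 1
    apply eq_of_unop e
    rw [map_mul, MulOpposite.unop_mul]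
    simp only [unop_rankOneElt]
    exact LinearMap.ext fun r => map_smul (e b).unop (toHom e φ r) p

theorem coinducedUnit_apply (n : N) (p : P) (φ : HomModule e A) :
    toHom e (coinducedUnit e N n) p φ = rankOneElt e p (toHom e φ) • n := rfl

/-- A dual basis `g`, `q` of `P` writes `1 ∈ B` as the sum of the rank one elements of `q c` and `g
c`. Applied to `n`, this recovers `n` from the values of its image at `q c` and `g c`; the same
formula, read off an arbitrary `H`, gives the preimage of `H`. -/
theorem coinducedUnit_bijective {β : Type*} [Fintype β] {g : β → P →ₗ[A] A} {q : β → P}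
    (hgq : ∀ p, ∑ c, g c p • q c = p) : Function.Bijective (coinducedUnit e N) := by
  have h1 : ∑ c, rankOneElt e (q c) (g c) = 1 := by
    apply eq_of_unop e
    rw [map_sum, map_one, MulOpposite.unop_one, Finset.unop_sum]
    simp only [unop_rankOneElt]
    exact LinearMap.ext fun p => by simp [hgq]
  constructor
  · rw [injective_iff_map_eq_zero]
    intro n hn
    rw [← one_smul B n, ← h1, Finset.sum_smul]
    refine Finset.sum_eq_zero fun c _ => ?_
    have := coinducedUnit_apply e N n (q c) (of e (g c))
    rw [hn] at this
    exact this.symm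
  · intro H
    refine ⟨∑ c, toHom e H (q c) (of e (g c)), ?_⟩
    refine LinearMap.ext fun p => CoinducedModule.ext fun φ => ?_
    refine (coinducedUnit_apply e N _ p φ).trans ?_
    have key : ∀ c, rankOneElt e p (toHom e φ) • toHom e H (q c) (of e (g c)) =
        toHom e H (g c p • q c) φ := fun c => by
      rw [map_smul, CoinducedModule.smul_apply]
      refine (LinearMap.map_smul (toHom e H (q c) : HomModule e A →ₗ[B] N) _ _).symm.trans ?_
      refine congrArg (toHom e H (q c)) ?_
      rw [smul_of, unop_rankOneElt]
      exact LinearMap.ext fun r => map_smul (g c) (toHom e φ r) p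
    rw [Finset.smul_sum, Finset.sum_congr rfl fun c _ => key c]
    conv_rhs => rw [← hgq p]
    change _ = toHom e H _ φ
    rw [map_sum]
    exact (LinearMap.sum_apply (ι := β) _ (fun c => (toHom e H (g c p • q c) :
      HomModule e A →ₗ[B] N)) φ).symm

end Progenerator

/-! ### The Morita equivalence given by a progenerator -/

section

universe u₀ u₁ u₂ u₃

variable {K : Type u₀} [CommRing K] {A : Type u₁} [Ring A] [Algebra K A] {B : Type u₂} [Ring B]
  [Algebra K B] {P : Type (max u₁ u₂)} [AddCommGroup P] [Module A P] [Module K P]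
  [IsScalarTower K A P]

/-- The functor `Hom_A(P, -)`. -/
def homModuleFunctor (e : B ≃ₐ[K] (Module.End A P)ᵐᵒᵖ) :
    ModuleCat.{max u₁ u₂} A ⥤ ModuleCat.{max u₁ u₂} B where
  obj X := ModuleCat.of B (HomModule e X)
  map g := ModuleCat.ofHom (HomModule.map e g.hom)

open scoped ModuleCat.Algebra in
/-- An algebra is Morita equivalent to the (opposite) endomorphism algebra of a progenerator. -/
theorem isMoritaEquivalent_of_progenerator (e : B ≃ₐ[K] (Module.End A P)ᵐᵒᵖ)
    {α : Type*} [Fintype α] {f : α → P →ₗ[A] A} {p : α → P} (hfp : ∑ a, f a (p a) = 1)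
    [Module.Finite A P] [Module.Projective A P] : IsMoritaEquivalent K A B := by
  have : (homModuleFunctor e).Faithful := ⟨fun {X Y g g'} h => ModuleCat.hom_ext
    (HomModule.map_injective e hfp (congrArg ModuleCat.Hom.hom h))⟩
  have : (homModuleFunctor e).Full := ⟨fun {X Y} h => by
    obtain ⟨g, hg⟩ := HomModule.exists_map_eq e hfp h.hom
    exact ⟨ModuleCat.ofHom g, ModuleCat.hom_ext hg⟩⟩
  -- Full faithfulness used that `P` generates; here its being finitely generated projective enters,
  -- through the dual basis obtained from a splitting of a surjection from a free module.
  have : (homModuleFunctor e).EssSurj := ⟨fun N => by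
    obtain ⟨n, g, s, -, -, hs⟩ := Module.Finite.exists_comp_eq_id_of_projective A P
    have hgq : ∀ p, ∑ c, (LinearMap.proj c ∘ₗ s) p • g (Pi.single c 1) = p := fun p => by
      conv_rhs => rw [← LinearMap.id_apply (R := A) p, ← hs, LinearMap.comp_apply,
        LinearMap.pi_apply_eq_sum_univ g (s p)]
      refine Finset.sum_congr rfl fun c _ => ?_
      congr 2
      exact funext fun d => by simp [Pi.single_apply, eq_comm]
    exact ⟨ModuleCat.of A (CoinducedModule e N),
      ⟨(LinearEquiv.ofBijective _ (coinducedUnit_bijective e N hgq)).symm.toModuleIso⟩⟩⟩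
  have : (homModuleFunctor e).IsEquivalence := {}
  have hl : (homModuleFunctor e).Additive := ⟨fun {X Y g g'} => ModuleCat.hom_ext
    (LinearMap.ext fun x => LinearMap.add_comp _ _ _)⟩
  exact ⟨⟨{ eqv := (homModuleFunctor e).asEquivalence
            linear := ⟨fun {X Y} g k => by
              refine ModuleCat.hom_ext (LinearMap.ext fun x => LinearMap.ext fun q => ?_)
              -- The scalars act through `A` on one side and through `B` on the other; the two agree
              -- because `e` is an isomorphism of `K`-algebras.
              change algebraMap K A k • (g.hom (HomModule.toHom e x q)) =
                HomModule.toHom e (algebraMap K B k • HomModule.map e g.hom x) q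
              rw [HomModule.toHom_smul, AlgEquiv.commutes]
              have : (algebraMap K (Module.End A P)ᵐᵒᵖ k).unop q = algebraMap K A k • q := by
                rw [algebraMap_smul]; rfl
              rw [LinearMap.comp_apply, this, map_smul]
              rfl⟩ }⟩⟩

end

/-! ## Projective covers of simple modules -/

namespace IsProjectiveCover

variable {R : Type v} [Ring R] {P S : Type*} [AddCommGroup P] [Module R P] [AddCommGroup S]
  [Module R S] [IsSimpleModule R S] {π : P →ₗ[R] S}

theorem isCoatom_ker (h : IsProjectiveCover π) : IsCoatom (LinearMap.ker π) :=
  LinearMap.isCoatom_ker_of_surjective h.surjective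

/-- By superfluity of `ker π`, a submodule outside `ker π` is everything, so `ker π` is the only
maximal submodule; this identifies it with the radical. -/
theorem eq_ker_of_isCoatom (h : IsProjectiveCover π) {N : Submodule R P} (hN : IsCoatom N) :
    N = LinearMap.ker π := by
  have hle : N ≤ LinearMap.ker π := by
    by_contra hle
    exact hN.1 (h.eq_top_of_not_le hle)
  exact ((hN.le_iff.1 hle).resolve_left h.isCoatom_ker.1).symm

theorem jacobson_eq_ker (h : IsProjectiveCover π) : Module.jacobson R P = LinearMap.ker π :=
  le_antisymm (sInf_le h.isCoatom_ker) (le_sInf fun _ hN => (h.eq_ker_of_isCoatom hN).ge)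

theorem surjective_of_comp_ne_zero (h : IsProjectiveCover π) {X : Type*} [AddCommGroup X]
    [Module R X] (f : X →ₗ[R] P) (hf : π.comp f ≠ 0) : Function.Surjective f := by
  refine LinearMap.range_eq_top.1 (h.eq_top_of_not_le fun hle => hf (LinearMap.ext fun x => ?_))
  exact hle ⟨x, rfl⟩

theorem ne_zero (h : IsProjectiveCover π) : π ≠ 0 := by
  have := IsSimpleModule.nontrivial R S
  obtain ⟨s, hs⟩ := exists_ne (0 : S)
  obtain ⟨x, rfl⟩ := h.surjective s
  exact fun h0 => hs (by rw [h0]; rfl)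

/-- A simple quotient of a projective cover of a simple module `S` is isomorphic to `S`. -/
theorem nonempty_equiv_of_ne_zero (h : IsProjectiveCover π) {S' : Type*} [AddCommGroup S']
    [Module R S'] [IsSimpleModule R S'] (f : P →ₗ[R] S') (hf : f ≠ 0) :
    Nonempty (S' ≃ₗ[R] S) := by
  have hs : Function.Surjective f := LinearMap.surjective_of_ne_zero hf
  have hker := h.eq_ker_of_isCoatom (LinearMap.isCoatom_ker_of_surjective hs)
  exact ⟨((LinearMap.quotKerEquivOfSurjective f hs).symm.trans
    (Submodule.quotEquivOfEq _ _ hker)).trans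
    (LinearMap.quotKerEquivOfSurjective π h.surjective)⟩

end IsProjectiveCover

/-! ### Generation by the modules `P i`, and arrows read off from radicals -/

namespace SimpleSystem

variable {K : Type u} [Field K] {Λ : Type v} [Ring Λ] [Algebra K Λ] {ι : Type w}
  (D : SimpleSystem K Λ ι)

/-- A value outside the radical would make `π i ∘ f` nonzero, so `S i` would be a simple quotient of
`P j` and hence isomorphic to `S j`. -/
theorem mem_jacobson_of_ne {i j : ι} (hij : i ≠ j) (f : D.P j →ₗ[Λᵐᵒᵖ] D.P i) (x : D.P j) :
    f x ∈ Module.jacobson Λᵐᵒᵖ (D.P i) := by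
  rw [(D.cover i).jacobson_eq_ker]
  by_contra hx
  refine hij (D.eq_of_iso i j ((D.cover j).nonempty_equiv_of_ne_zero ((D.π i).comp f) ?_))
  exact fun h => hx (LinearMap.congr_fun h x)

/-- A morphism `P j → P i` for `i ≠ j`, seen as a morphism to the radical. -/
def toRad {i j : ι} (hij : i ≠ j) (f : D.P j →ₗ[Λᵐᵒᵖ] D.P i) : D.P j →ₗ[Λᵐᵒᵖ] Rad Λᵐᵒᵖ (D.P i) :=
  f.codRestrict _ (D.mem_jacobson_of_ne hij f)

/-- The modules `P i` generate `Λ`. -/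
theorem exists_sum_eq_one : ∃ (α : Type (max v w)) (_ : Fintype α) (k : α → ι)
    (f : ∀ a, D.P (k a) →ₗ[Λᵐᵒᵖ] Λᵐᵒᵖ) (p : ∀ a, D.P (k a)), ∑ a, f a (p a) = 1 := by
  let V : (Σ i, (D.P i →ₗ[Λᵐᵒᵖ] Λᵐᵒᵖ) × D.P i) → Λᵐᵒᵖ := fun x => x.2.1 x.2.2
  have htop : Submodule.span Λᵐᵒᵖ (Set.range V) = ⊤ := by
    refine (eq_top_or_exists_le_coatom (Submodule.span Λᵐᵒᵖ (Set.range V))).resolve_right ?_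
    -- If the values of all maps from the `P i` lay in a maximal `W`, the projective cover of the
    -- simple quotient by `W` would lift to a map with values in `W`, and so would vanish.
    rintro ⟨W, hW, hle⟩
    have := isSimpleModule_iff_isCoatom.2 hW
    obtain ⟨i, ⟨e⟩⟩ := D.exists_iso (Λᵐᵒᵖ ⧸ W)
    have := (D.cover i).projective
    obtain ⟨g, hg⟩ := Module.projective_lifting_property W.mkQ (e.symm.toLinearMap.comp (D.π i))
      W.mkQ_surjective
    refine (D.cover i).ne_zero (LinearMap.ext fun x => e.symm.injective ?_)
    have h1 : g x ∈ W := hle (Submodule.subset_span ⟨⟨i, g, x⟩, rfl⟩)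
    have h2 := LinearMap.congr_fun hg x
    rw [LinearMap.comp_apply, Submodule.mkQ_apply, (Submodule.Quotient.mk_eq_zero W).2 h1] at h2
    rw [LinearMap.zero_apply, map_zero]
    exact h2.symm
  obtain ⟨c, hc⟩ := Finsupp.mem_span_range_iff_exists_finsupp.1
    (htop ▸ Submodule.mem_top : (1 : Λᵐᵒᵖ) ∈ Submodule.span Λᵐᵒᵖ (Set.range V))
  refine ⟨c.support, inferInstance, fun a => a.1.1, fun a => a.1.2.1, fun a => c a • a.1.2.2, ?_⟩
  rw [Finsupp.sum, ← Finset.sum_coe_sort] at hc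
  refine (Finset.sum_congr rfl fun a _ => ?_).trans hc
  exact map_smul a.1.2.1 _ _

/-- A finitely generated projective module is a direct summand of a finite direct sum of modules
`P i`. -/
theorem exists_factorization (X : Type v) [AddCommGroup X] [Module Λᵐᵒᵖ X]
    [Module.Finite Λᵐᵒᵖ X] [Module.Projective Λᵐᵒᵖ X] :
    ∃ (α : Type (max v w)) (_ : Fintype α) (k : α → ι)
      (s : ∀ a, X →ₗ[Λᵐᵒᵖ] D.P (k a)) (t : ∀ a, D.P (k a) →ₗ[Λᵐᵒᵖ] X),
        ∀ x, ∑ a, t a (s a x) = x := by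
  obtain ⟨α, _, k, f, p, hfp⟩ := D.exists_sum_eq_one
  obtain ⟨n, g, s, -, -, hs⟩ := Module.Finite.exists_comp_eq_id_of_projective Λᵐᵒᵖ X
  -- Each of the `n` coordinates of a free module containing `X` as a summand is routed through the
  -- `P (k a)`, by inserting `1 = ∑ f a (p a)`.
  refine ⟨Fin n × α, inferInstance, fun c => k c.2,
    fun c => (LinearMap.toSpanSingleton Λᵐᵒᵖ _ (p c.2)).comp ((LinearMap.proj c.1).comp s),
    fun c => (LinearMap.toSpanSingleton Λᵐᵒᵖ X (g (Pi.single c.1 1))).comp (f c.2), fun x => ?_⟩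
  conv_rhs => rw [← LinearMap.id_apply (R := Λᵐᵒᵖ) x, ← hs, LinearMap.comp_apply,
    LinearMap.pi_apply_eq_sum_univ g (s x)]
  rw [Fintype.sum_prod_type]
  refine Finset.sum_congr rfl fun c _ => ?_
  have : (Pi.single c 1 : Fin n → Λᵐᵒᵖ) = fun j => if c = j then 1 else 0 :=
    funext fun d => by simp [Pi.single_apply, eq_comm]
  simp only [LinearMap.comp_apply, LinearMap.toSpanSingleton_apply, map_smul, LinearMap.proj_apply,
    ← this]
  rw [← Finset.smul_sum, ← Finset.sum_smul, hfp, one_smul]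

/-- If `Ext¹(S i, S j)` vanished, the long exact sequence of `0 → rP i → P i → S i → 0` would extend
`φ` to `P i`. A nonzero map from `P i` to a simple module has the unique maximal submodule `rP i` as
its kernel, so its restriction `φ` would be zero. -/
theorem arrow_of_ne_zero {i j : ι} (φ : Rad Λᵐᵒᵖ (D.P i) →ₗ[Λᵐᵒᵖ] D.S j) (hφ : φ ≠ 0) :
    D.Arrow i j := by
  by_contra hall
  have hsub : Subsingleton
      (Abelian.Ext (ModuleCat.of Λᵐᵒᵖ (D.S i)) (ModuleCat.of Λᵐᵒᵖ (D.S j)) 1) :=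
    not_nontrivial_iff_subsingleton.1 hall
  have hker : ∀ x, x ∈ Module.jacobson Λᵐᵒᵖ (D.P i) ↔ D.π i x = 0 := fun x => by
    rw [(D.cover i).jacobson_eq_ker, LinearMap.mem_ker]
  let C : ShortComplex (ModuleCat.{v} Λᵐᵒᵖ) := ShortComplex.mk
    (ModuleCat.ofHom (Module.jacobson Λᵐᵒᵖ (D.P i)).subtype) (ModuleCat.ofHom (D.π i)) (by
      ext x; exact (hker _).1 x.2)
  have hC : C.ShortExact := by
    refine ShortComplex.ShortExact.mk' ?_ ?_ ?_
    · rw [ShortComplex.moduleCat_exact_iff]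
      intro x hx
      exact ⟨⟨x, (hker x).2 hx⟩, rfl⟩
    · exact (ModuleCat.mono_iff_injective _).2 Subtype.val_injective
    · exact (ModuleCat.epi_iff_surjective _).2 (D.cover i).surjective
  obtain ⟨x, hx⟩ := Abelian.Ext.contravariant_sequence_exact₁ hC (ModuleCat.of Λᵐᵒᵖ (D.S j))
    (Abelian.Ext.mk₀ (ModuleCat.ofHom φ)) (add_comm 1 0) (hsub.elim _ _)
  obtain ⟨f, rfl⟩ := (Abelian.Ext.mk₀_bijective _ _).2 x
  rw [Abelian.Ext.mk₀_comp_mk₀] at hx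
  have hf := congrArg ModuleCat.Hom.hom ((Abelian.Ext.mk₀_bijective _ _).1 hx)
  have hfx : ∀ x : Rad Λᵐᵒᵖ (D.P i), f.hom (x : D.P i) = φ x := fun x => LinearMap.congr_fun hf x
  let f' : D.P i →ₗ[Λᵐᵒᵖ] D.S j := f.hom
  have hf0 : f' ≠ 0 := fun h0 => hφ (LinearMap.ext fun x =>
    (hfx x).symm.trans (LinearMap.congr_fun h0 (x : D.P i)))
  have hk := (D.cover i).eq_ker_of_isCoatom (LinearMap.isCoatom_ker_of_surjective
    (LinearMap.surjective_of_ne_zero hf0))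
  refine hφ (LinearMap.ext fun x => (hfx x).symm.trans ?_)
  have : (x : D.P i) ∈ LinearMap.ker f' := by
    rw [hk, ← (D.cover i).jacobson_eq_ker]
    exact x.2
  exact this

/-- Lift `g` to `rP i`. Some value of the lift avoids a maximal submodule `W` of `rP i`; then `rP i
/ W` is a simple quotient of `P j`, hence isomorphic to `S j`, and `arrow_of_ne_zero` applies to the
projection. -/
theorem arrow_of_radTopHom_ne_zero {i j : ι} (g : RadTopHom Λᵐᵒᵖ (D.P i) (D.P j)) (hg : g ≠ 0) :
    D.Arrow i j := by
  have := (D.cover j).projective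
  let g' : D.P j →ₗ[Λᵐᵒᵖ] RadTop Λᵐᵒᵖ (D.P i) := g
  obtain ⟨h, hh⟩ := Module.projective_lifting_property (Module.jacobson Λᵐᵒᵖ (Rad Λᵐᵒᵖ (D.P i))).mkQ
    g' (Submodule.mkQ_surjective _)
  obtain ⟨x, hx⟩ : ∃ x, h x ∉ Module.jacobson Λᵐᵒᵖ (Rad Λᵐᵒᵖ (D.P i)) := by
    by_contra! hall
    refine hg (LinearMap.ext fun x => ?_)
    exact (LinearMap.congr_fun hh x).symm.trans ((Submodule.Quotient.mk_eq_zero _).2 (hall x))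
  obtain ⟨W, hW, hxW⟩ : ∃ W, IsCoatom W ∧ h x ∉ W := by
    by_contra! hall
    exact hx (Submodule.mem_sInf.2 fun W hW => hall W hW)
  have := isSimpleModule_iff_isCoatom.2 hW
  have hne : W.mkQ.comp h ≠ 0 := fun h0 =>
    hxW ((Submodule.Quotient.mk_eq_zero W).1 (LinearMap.congr_fun h0 x))
  obtain ⟨e⟩ := (D.cover j).nonempty_equiv_of_ne_zero _ hne
  refine D.arrow_of_ne_zero (e.toLinearMap.comp W.mkQ) fun h0 => hxW ?_
  refine (Submodule.Quotient.mk_eq_zero W).1 (e.injective ?_)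
  exact (LinearMap.congr_fun h0 (h x)).trans (map_zero e).symm

/-- Homomorphisms that factor through a nonisomorphism of modules `P k` are zero modulo the square
of the radical. -/
theorem radTop_comp_eq_zero {i j k : ι} (hjk : j ≠ k)
    (m : D.P j →ₗ[Λᵐᵒᵖ] RadTop Λᵐᵒᵖ (D.P i)) (f : D.P k →ₗ[Λᵐᵒᵖ] D.P j) : m.comp f = 0 := by
  refine LinearMap.ext fun x => ?_
  have h := Module.le_comap_jacobson m (D.mem_jacobson_of_ne hjk f x)
  rwa [Submodule.mem_comap, Module.jacobson_quotient_jacobson, Submodule.mem_bot] at h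

section RadicalDecomposition

variable {i : ι} {B : Type*} [Fintype B] {j : B → ι}
  (s : ∀ b, D.P (j b) →ₗ[Λᵐᵒᵖ] Rad Λᵐᵒᵖ (D.P i))

/-- The homomorphism `⨁ P (j b) → rP` with the given components. -/
def radSum : (∀ b, D.P (j b)) →ₗ[Λᵐᵒᵖ] Rad Λᵐᵒᵖ (D.P i) :=
  ∑ b, (s b).comp (LinearMap.proj b)

theorem radSum_apply (x : ∀ b, D.P (j b)) : D.radSum s x = ∑ b, s b (x b) := by
  simp [radSum]

end RadicalDecomposition

/-! ### Dimension arguments and the decomposition of `rP i` -/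

section Finite

variable [Module.Finite K Λ]

theorem finite_opposite : Module.Finite K Λᵐᵒᵖ := Module.Finite.equiv (MulOpposite.opLinearEquiv K)

include D in
theorem isNoetherian (i : ι) : IsNoetherian Λᵐᵒᵖ (D.P i) :=
  have := finite_opposite (K := K) (Λ := Λ)
  have := (D.cover i).finite K
  isNoetherian_of_tower K inferInstance

/-- The map is injective since `Λ` is hereditary, and its image lies in the proper submodule `rP i`.
-/
theorem finrank_lt_of_ne (hΛ : IsRightHereditary Λ) {i j : ι} (hij : i ≠ j)
    (f : D.P j →ₗ[Λᵐᵒᵖ] D.P i) (hf : f ≠ 0) :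
    Module.finrank K (D.P j) < Module.finrank K (D.P i) := by
  have := finite_opposite (K := K) (Λ := Λ)
  have := (D.cover i).finite K
  have hinj := (D.cover j).injective_of_ne_zero (D.cover i) hΛ f hf
  rw [← LinearMap.finrank_range_of_inj (f := f.restrictScalars K) hinj]
  refine Submodule.finrank_lt fun htop => (D.cover i).isCoatom_ker.1 ?_
  rw [eq_top_iff]
  rintro x -
  obtain ⟨y, rfl⟩ := LinearMap.range_eq_top.1 htop x
  rw [← (D.cover i).jacobson_eq_ker]
  exact D.mem_jacobson_of_ne hij f y

section RadicalDecomposition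

variable {i : ι} {B : Type*} [Fintype B] {j : B → ι}
  (s : ∀ b, D.P (j b) →ₗ[Λᵐᵒᵖ] Rad Λᵐᵒᵖ (D.P i))

variable {s}

/-- Nakayama: a proper image would lie in a maximal `W`, with `rP i / W` isomorphic to some `S k`.
The lift `h : P k → rP i` of the cover agrees with a combination of the `s b` modulo `r²P i`, which
is contained in `W`, so it would take values in `W`. -/
theorem radSum_surjective (hgen : ∀ k (g : D.P k →ₗ[Λᵐᵒᵖ] RadTop Λᵐᵒᵖ (D.P i)),
      ∃ c : ∀ b, D.P k →ₗ[Λᵐᵒᵖ] D.P (j b),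
        g = ∑ b, ((Module.jacobson Λᵐᵒᵖ (Rad Λᵐᵒᵖ (D.P i))).mkQ.comp (s b)).comp (c b)) :
    Function.Surjective (D.radSum s) := by
  have := D.isNoetherian i
  refine LinearMap.range_eq_top.1
    ((eq_top_or_exists_le_coatom (LinearMap.range (D.radSum s))).resolve_right ?_)
  rintro ⟨W, hW, hle⟩
  have := isSimpleModule_iff_isCoatom.2 hW
  obtain ⟨k, ⟨e⟩⟩ := D.exists_iso (Rad Λᵐᵒᵖ (D.P i) ⧸ W)
  have := (D.cover k).projective
  obtain ⟨h, hh⟩ := Module.projective_lifting_property W.mkQ (e.symm.toLinearMap.comp (D.π k))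
    W.mkQ_surjective
  obtain ⟨c, hc⟩ := hgen k ((Module.jacobson Λᵐᵒᵖ (Rad Λᵐᵒᵖ (D.P i))).mkQ.comp h)
  refine (D.cover k).ne_zero (LinearMap.ext fun x => e.symm.injective ?_)
  have h1 : h x - D.radSum s (fun b => c b x) ∈ Module.jacobson Λᵐᵒᵖ (Rad Λᵐᵒᵖ (D.P i)) := by
    rw [← Submodule.Quotient.mk_eq_zero, ← Submodule.mkQ_apply, map_sub, sub_eq_zero,
      ← LinearMap.comp_apply, hc, radSum_apply]
    simp
  have h2 : h x ∈ W := (W.sub_mem_iff_left (hle ⟨fun b => c b x, rfl⟩)).1 (Submodule.mem_sInf.1 h1 W hW)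
  have h3 := LinearMap.congr_fun hh x
  rw [LinearMap.comp_apply, Submodule.mkQ_apply, (Submodule.Quotient.mk_eq_zero W).2 h2] at h3
  rw [LinearMap.zero_apply, map_zero]
  exact h3.symm

/-- Projectivity of `rP i` splits the map, so its kernel is the image of an idempotent `E`.
Independence modulo `r²P i` removes the matrix entries of `E` between equal vertices, and the
remaining ones strictly raise the dimension; a strictly triangular idempotent is zero. -/
theorem radSum_injective (hΛ : IsRightHereditary Λ)
    (hind : ∀ k (c : ∀ b, D.P k →ₗ[Λᵐᵒᵖ] D.P (j b)),
      ∑ b, ((Module.jacobson Λᵐᵒᵖ (Rad Λᵐᵒᵖ (D.P i))).mkQ.comp (s b)).comp (c b) = 0 →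
        ∀ b, j b = k → c b = 0)
    (hsurj : Function.Surjective (D.radSum s)) : Function.Injective (D.radSum s) := by
  classical
  have := (D.cover i).projective_submodule hΛ (Module.jacobson Λᵐᵒᵖ (D.P i))
  obtain ⟨r, hr⟩ := Module.projective_lifting_property (D.radSum s) LinearMap.id hsurj
  let E : Module.End Λᵐᵒᵖ (∀ b, D.P (j b)) := 1 - r.comp (D.radSum s)
  have hrE : ∀ x, D.radSum s (E x) = 0 := fun x => by
    have := LinearMap.congr_fun hr (D.radSum s x)
    simp only [LinearMap.comp_apply, LinearMap.id_apply] at this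
    simp [E, this]
  have hEE : ∀ x, E (E x) = E x := fun x => by
    conv_lhs => rw [show E (E x) = E x - r (D.radSum s (E x)) from rfl, hrE, map_zero, sub_zero]
  let e : ∀ b c, D.P (j c) →ₗ[Λᵐᵒᵖ] D.P (j b) := fun b c =>
    (LinearMap.proj b).comp (E.comp (LinearMap.single Λᵐᵒᵖ _ c))
  have he : ∀ b c, e b c = ∑ d, (e b d).comp (e d c) := fun b c => by
    refine LinearMap.ext fun x => ?_
    change E (Pi.single c x) b = _
    rw [← hEE, LinearMap.sum_apply]
    conv_lhs => rw [← Finset.univ_sum_single (E (Pi.single c x)), map_sum, Finset.sum_apply]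
    rfl
  -- Column `c` of `E` is a linear relation among the `s b`, already in `rP i` and so modulo the
  -- square of the radical.
  have he0 : ∀ b c, j b = j c → e b c = 0 := fun b c hbc => by
    refine hind (j c) (fun b => e b c) (LinearMap.ext fun x => ?_) b hbc
    have := hrE (Pi.single c x)
    rw [radSum_apply] at this
    have h2 := congrArg (Module.jacobson Λᵐᵒᵖ (Rad Λᵐᵒᵖ (D.P i))).mkQ this
    rw [map_sum, map_zero] at h2
    rw [LinearMap.sum_apply]
    exact h2
  have hlt : ∀ b c, e b c ≠ 0 →
      Module.finrank K (D.P (j c)) < Module.finrank K (D.P (j b)) := fun b c h =>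
    D.finrank_lt_of_ne hΛ (fun hbc => h (he0 b c hbc)) _ h
  -- Induction on the gap in dimension. With truncated subtraction, gap zero means that the
  -- dimension does not rise, so the entry vanishes; for larger gaps, expanding `E = E²` passes
  -- through a vertex of intermediate dimension.
  have hzero : ∀ n b c, Module.finrank K (D.P (j b)) - Module.finrank K (D.P (j c)) ≤ n →
      e b c = 0 := by
    intro n
    induction n with
    | zero =>
      intro b c hn
      by_contra h
      have := hlt b c h
      omega
    | succ n ih =>
      intro b c hn
      rw [he]
      refine Finset.sum_eq_zero fun d _ => ?_
      by_cases hdc : e d c = 0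
      · rw [hdc, LinearMap.comp_zero]
      by_cases hbd : e b d = 0
      · rw [hbd, LinearMap.zero_comp]
      have h1 := hlt _ _ hdc
      have h2 := hlt _ _ hbd
      rw [ih b d (by omega), LinearMap.zero_comp]
  have hE : ∀ x, E x = 0 := fun x => by
    rw [← Finset.univ_sum_single x, map_sum]
    refine Finset.sum_eq_zero fun c _ => funext fun b => ?_
    exact LinearMap.congr_fun (hzero _ b c le_rfl) (x c)
  rw [injective_iff_map_eq_zero]
  intro x hx
  have := hE x
  rwa [show E x = x - r (D.radSum s x) from rfl, hx, map_zero, sub_zero] at this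

end RadicalDecomposition

end Finite

end SimpleSystem

/-! ## Realizations of modulated quivers by modules -/

/-- This rewrites an expansion in the basis of one arrow bimodule as an expansion over all arrows
leaving a vertex, with zero coefficients elsewhere. -/
theorem sum_apply_sum_single {B L X : Type*} [Fintype B] [DecidableEq B] [Fintype L]
    {N : B → Type*} [∀ b, AddCommMonoid (N b)] [AddCommMonoid X] (T : ∀ b, N b →+ X) (e : L → B)
    (c : ∀ l, N (e l)) :
    ∑ b, T b ((∑ l, Pi.single (e l) (c l) : ∀ b, N b) b) = ∑ l, T (e l) (c l) := by
  simp only [Finset.sum_apply, map_sum]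
  rw [Finset.sum_comm]
  refine Finset.sum_congr rfl fun l _ => ?_
  rw [Finset.sum_eq_single (e l)]
  · rw [Pi.single_eq_same]
  · intro b _ hb
    rw [Pi.single_eq_of_ne hb, map_zero]
  · exact fun h => absurd (Finset.mem_univ _) h

namespace ModulatedQuiver

variable {K : Type u} [Field K] (Q : ModulatedQuiver.{u, v, w} K)

/-- The element of the path sum given by an element of an arrow bimodule. -/
noncomputable def arrowElt {i j : Q.V} (a : i ⟶ j) : Q.bimodule a →ₗ[K] Q.PathSum i j :=
  (Q.incl (Quiver.Path.nil.cons a)).comp ((Q.consEquiv .nil a).toLinearMap.comp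
    (BalancedTensor.mk K (Q.F i) (Q.TensorPath .nil) (Q.bimodule a) (Q.nilEquiv i 1)))

theorem arrowElt_eq {i j : Q.V} (a : i ⟶ j) (m : Q.bimodule a) :
    Q.arrowElt a m = Q.incl (Quiver.Path.nil.cons a) (Q.snoc (Q.nilEquiv i 1) a m) := rfl

/-- Appending an arrow is multiplication by its degree one element, so path sums are generated by
vertices and arrows. -/
theorem incl_snoc {i j k : Q.V} (p : Quiver.Path i j) (t : Q.TensorPath p) (a : j ⟶ k)
    (m : Q.bimodule a) :
    Q.incl (p.cons a) (Q.snoc t a m) = Q.comp i j k (Q.incl p t) (Q.arrowElt a m) := by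
  rw [arrowElt_eq, comp_incl, concat_snoc, concat_nil, MulOpposite.op_one, one_smul]
  rfl

theorem arrowElt_left_smul {i j : Q.V} (a : i ⟶ j) (f : Q.F i) (m : Q.bimodule a) :
    Q.arrowElt a (f • m) = Q.comp i i j (Q.incl .nil (Q.nilEquiv i f)) (Q.arrowElt a m) := by
  rw [← incl_snoc, arrowElt_eq]
  refine congrArg (Q.incl (Quiver.Path.nil.cons a)) ?_
  refine congrArg (Q.consEquiv .nil a) ?_
  rw [← BalancedTensor.smul_tmul, smul_nilEquiv, MulOpposite.unop_op, one_mul]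

theorem arrowElt_right_smul {i j : Q.V} (a : i ⟶ j) (g : Q.F j) (m : Q.bimodule a) :
    Q.arrowElt a (MulOpposite.op g • m) =
      Q.comp i j j (Q.arrowElt a m) (Q.incl .nil (Q.nilEquiv j g)) := by
  rw [arrowElt_eq, arrowElt_eq, comp_incl, concat_nil]
  refine congrArg (Q.incl (Quiver.Path.nil.cons a)) ?_
  exact congrArg (Q.consEquiv .nil a) (BalancedTensor.right_smul_tmul (K := K) (F := Q.F i)
    (MulOpposite.op g) (Q.nilEquiv i 1) m).symm

theorem mem_of_incl_mem {i j : Q.V} {S : Submodule K (Q.PathSum i j)}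
    (h : ∀ p t, Q.incl p t ∈ S) (x : Q.PathSum i j) : x ∈ S := by
  have : S.mkQ = 0 := Q.pathSum_hom_ext fun p t =>
    (Submodule.Quotient.mk_eq_zero S).2 (h p t)
  exact (Submodule.Quotient.mk_eq_zero S).1 (LinearMap.congr_fun this x)

theorem incl_cons_mem {i j k : Q.V} {S : Submodule K (Q.PathSum i k)} {p : Quiver.Path i j}
    {a : j ⟶ k} (h : ∀ t m, Q.incl (p.cons a) (Q.snoc t a m) ∈ S) (x : Q.TensorPath (p.cons a)) :
    Q.incl (p.cons a) x ∈ S := by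
  have : S.mkQ.comp (Q.incl (p.cons a)) = 0 := Q.tensorPath_cons_ext fun t m =>
    (Submodule.Quotient.mk_eq_zero S).2 (h t m)
  exact (Submodule.Quotient.mk_eq_zero S).1 (LinearMap.congr_fun this x)

theorem transGen_of_path {i j : Q.V} (p : Quiver.Path i j) (hp : p.length ≠ 0) :
    Relation.TransGen Q.Arrow i j := by
  induction p with
  | nil => exact absurd rfl hp
  | cons p a ih =>
    cases p with
    | nil => exact .single a.down
    | cons p b => exact (ih (Nat.succ_ne_zero _)).tail a.down

theorem length_eq_zero_of_cycle {i : Q.V} (p : Quiver.Path i i) : p.length = 0 := by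
  by_contra h
  exact Q.acyclic i (Q.transGen_of_path p h)

/-- A path sum at one vertex consists of the division algebra at that vertex. -/
theorem exists_eq_nil {i : Q.V} (x : Q.PathSum i i) :
    ∃ f : Q.F i, x = Q.incl .nil (Q.nilEquiv i f) := by
  suffices x ∈ LinearMap.range ((Q.incl (.nil : Quiver.Path i i)).comp
      (Q.nilEquiv i).toLinearMap) by
    obtain ⟨f, hf⟩ := this
    exact ⟨f, hf.symm⟩
  refine Q.mem_of_incl_mem (fun p t => ?_) x
  obtain rfl : p = .nil := Quiver.Path.eq_nil_of_length_zero p (Q.length_eq_zero_of_cycle p)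
  exact ⟨(Q.nilEquiv i).symm t, congrArg _ ((Q.nilEquiv i).apply_symm_apply t)⟩

/-- The span of the elements `m ⊗ y` in a path sum, with `m` in an arrow bimodule. -/
noncomputable def leftSpan (i k : Q.V) : Submodule K (Q.PathSum i k) :=
  Submodule.span K {x | ∃ (j : Q.V) (a : i ⟶ j) (m : Q.bimodule a) (y : Q.PathSum j k),
    x = Q.comp i j k (Q.arrowElt a m) y}

theorem comp_mem_leftSpan {i j k : Q.V} {x : Q.PathSum i j} (hx : x ∈ Q.leftSpan i j)
    (z : Q.PathSum j k) : Q.comp i j k x z ∈ Q.leftSpan i k := by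
  induction hx using Submodule.span_induction with
  | mem x hx =>
    obtain ⟨l, a, m, y, rfl⟩ := hx
    rw [comp_assoc]
    exact Submodule.subset_span ⟨l, a, m, _, rfl⟩
  | zero => rw [map_zero]; exact Submodule.zero_mem _
  | add x y _ _ hx hy => rw [map_add]; exact Submodule.add_mem _ hx hy
  | smul c x _ hx => rw [map_smul]; exact Submodule.smul_mem _ c hx

theorem arrowElt_mem_leftSpan {i j : Q.V} (a : i ⟶ j) (m : Q.bimodule a) :
    Q.arrowElt a m ∈ Q.leftSpan i j :=
  Submodule.subset_span ⟨j, a, m, Q.idPath j, (Q.comp_id _).symm⟩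

/-- Paths are built by adding arrows at the end, whereas the recursion on homomorphisms into `P i`
needs the first arrow. Induction on the path moves it to the front; for a single arrow, `f ⊗ m` is
the arrow element of `f • m`. -/
theorem incl_mem_leftSpan {i k : Q.V} (p : Quiver.Path i k) (hp : p.length ≠ 0)
    (t : Q.TensorPath p) : Q.incl p t ∈ Q.leftSpan i k := by
  induction p with
  | nil => exact absurd rfl hp
  | cons p a ih =>
    refine Q.incl_cons_mem (fun t m => ?_) t
    rw [incl_snoc]
    by_cases h : p.length = 0
    · obtain rfl := Quiver.Path.eq_of_length_zero p h
      obtain rfl := Quiver.Path.eq_nil_of_length_zero p h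
      obtain ⟨f, rfl⟩ := (Q.nilEquiv _).surjective t
      rw [← arrowElt_left_smul]
      exact Q.arrowElt_mem_leftSpan a _
    · exact Q.comp_mem_leftSpan (ih h t) _

theorem mem_leftSpan_of_ne {i k : Q.V} (h : i ≠ k) (x : Q.PathSum i k) : x ∈ Q.leftSpan i k :=
  Q.mem_of_incl_mem (fun p t => Q.incl_mem_leftSpan p
    (fun h0 => h (Quiver.Path.eq_of_length_zero p h0)) t) x

/-- If the elements `m i j a l` generate the arrow bimodules as right modules, then every element of
an arrow bimodule is a combination of them in the path sum. -/
theorem exists_arrowElt_eq_sum {β : Q.V → Q.V → Type*} [∀ i j, Fintype (β i j)]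
    [∀ i, Fintype (Σ x : {j // Q.Arrow i j}, β i x.1)]
    (m : ∀ i j (a : Q.Arrow i j), β i j → Q.M i j a)
    (hm : ∀ i j (a : Q.Arrow i j) (x : Q.M i j a), ∃ c : β i j → Q.F j,
      x = ∑ l, MulOpposite.op (c l) • m i j a l) {i k : Q.V} (a : i ⟶ k) (x : Q.bimodule a) :
    ∃ y : ∀ b : Σ x : {j // Q.Arrow i j}, β i x.1, Q.PathSum b.1.1 k,
      Q.arrowElt a x = ∑ b, Q.comp i b.1.1 k
        (Q.arrowElt (⟨b.1.2⟩ : i ⟶ b.1.1) (m i b.1.1 b.1.2 b.2)) (y b) := by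
  classical
  obtain ⟨c, rfl⟩ := hm i k a.down x
  refine ⟨∑ l : β i k, Pi.single (⟨⟨k, a.down⟩, l⟩ : Σ x : {j // Q.Arrow i j}, β i x.1)
    (Q.incl .nil (Q.nilEquiv k (c l))), ?_⟩
  rw [map_sum]
  refine Eq.trans ?_ (sum_apply_sum_single
    (N := fun b : Σ x : {j // Q.Arrow i j}, β i x.1 => Q.PathSum b.1.1 k)
    (fun b => (Q.comp i b.1.1 k
      (Q.arrowElt (⟨b.1.2⟩ : i ⟶ b.1.1) (m i b.1.1 b.1.2 b.2))).toAddMonoidHom) _ _).symm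
  exact Finset.sum_congr rfl fun l _ => Q.arrowElt_right_smul a (c l) (m i k a.down l)

/-- A realization of a modulated quiver by modules `P i` over an algebra `A`: the algebra `F i`
acts on `P i`, and the bimodule `M i j` acts by homomorphisms `P j → P i`. -/
structure Realization (A : Type v) [Ring A] [Algebra K A] (P : Q.V → Type v)
    [∀ i, AddCommGroup (P i)] [∀ i, Module A (P i)] [∀ i, Module K (P i)]
    [∀ i, IsScalarTower K A (P i)] where
  vertex : ∀ i, Q.F i →ₐ[K] Module.End A (P i)
  arrow : ∀ {i j : Q.V} (a : i ⟶ j), Q.bimodule a →ₗ[K] (P j →ₗ[A] P i)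
  arrow_left_smul : ∀ {i j : Q.V} (a : i ⟶ j) (f : Q.F i) (m : Q.bimodule a),
    arrow a (f • m) = (vertex i f).comp (arrow a m)
  arrow_right_smul : ∀ {i j : Q.V} (a : i ⟶ j) (g : Q.F j) (m : Q.bimodule a),
    arrow a (MulOpposite.op g • m) = (arrow a m).comp (vertex j g)

/-! ### Evaluation of path sums as homomorphisms -/

namespace Realization

variable {Q} {A : Type v} [Ring A] [Algebra K A] {P : Q.V → Type v}
    [∀ i, AddCommGroup (P i)] [∀ i, Module A (P i)] [∀ i, Module K (P i)]
    [∀ i, IsScalarTower K A (P i)] (ρ : Q.Realization A P)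

/-- Composition of homomorphisms as a bilinear map. -/
def compₗ (i j k : Q.V) : (P j →ₗ[A] P i) →ₗ[K] (P k →ₗ[A] P j) →ₗ[K] (P k →ₗ[A] P i) :=
  LinearMap.mk₂ K (fun f g => f.comp g) (fun _ _ _ => rfl) (fun _ _ _ => rfl)
    (fun f g h => LinearMap.comp_add g h f)
    (fun c f g => LinearMap.ext fun x => (f.restrictScalars K).map_smul c (g x))

/-- Left compatibility of the arrows with the vertices is exactly what lets composition descend to
the tensor product over `F j`. -/
theorem extendPath_balanced {i j k : Q.V} {p : Quiver.Path i j}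
    (c : Q.TensorPath p →ₗ[K] (P j →ₗ[A] P i))
    (hc : ∀ x (g : (Q.F j)ᵐᵒᵖ), c (g • x) = (c x).comp (ρ.vertex j g.unop)) (a : j ⟶ k)
    (x : Q.TensorPath p) (f : Q.F j) (m : Q.bimodule a) :
    (((compₗ i j k).comp c).compl₂ (ρ.arrow a)) (MulOpposite.op f • x) m =
      (((compₗ i j k).comp c).compl₂ (ρ.arrow a)) x (f • m) := by
  change (c (MulOpposite.op f • x)).comp (ρ.arrow a m) = (c x).comp (ρ.arrow a (f • m))
  rw [hc, ρ.arrow_left_smul]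
  rfl

/-- The action of a tensor path that ends in the arrow `a`. -/
noncomputable def extendPath {i j k : Q.V} {p : Quiver.Path i j}
    (c : Q.TensorPath p →ₗ[K] (P j →ₗ[A] P i))
    (hc : ∀ x (g : (Q.F j)ᵐᵒᵖ), c (g • x) = (c x).comp (ρ.vertex j g.unop)) (a : j ⟶ k) :
    Q.TensorPath (p.cons a) →ₗ[K] (P k →ₗ[A] P i) :=
  (BalancedTensor.lift (((compₗ i j k).comp c).compl₂ (ρ.arrow a))
    (ρ.extendPath_balanced c hc a)).comp (Q.consEquiv p a).symm.toLinearMap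

theorem extendPath_snoc {i j k : Q.V} {p : Quiver.Path i j}
    (c : Q.TensorPath p →ₗ[K] (P j →ₗ[A] P i))
    (hc : ∀ x (g : (Q.F j)ᵐᵒᵖ), c (g • x) = (c x).comp (ρ.vertex j g.unop)) (a : j ⟶ k)
    (t : Q.TensorPath p) (m : Q.bimodule a) :
    ρ.extendPath c hc a (Q.snoc t a m) = (c t).comp (ρ.arrow a m) :=
  BalancedTensor.lift_tmul (((compₗ i j k).comp c).compl₂ (ρ.arrow a))
    (ρ.extendPath_balanced c hc a) t m

theorem extendPath_smul {i j k : Q.V} {p : Quiver.Path i j}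
    (c : Q.TensorPath p →ₗ[K] (P j →ₗ[A] P i))
    (hc : ∀ x (g : (Q.F j)ᵐᵒᵖ), c (g • x) = (c x).comp (ρ.vertex j g.unop)) (a : j ⟶ k)
    (x : Q.TensorPath (p.cons a)) (g : (Q.F k)ᵐᵒᵖ) :
    ρ.extendPath c hc a (g • x) = (ρ.extendPath c hc a x).comp (ρ.vertex k g.unop) := by
  refine LinearMap.congr_fun (Q.tensorPath_cons_ext
    (g := (ρ.extendPath c hc a).comp (Module.toModuleEnd K (S := (Q.F k)ᵐᵒᵖ) _ g))
    (h := ((compₗ i k k).flip (ρ.vertex k g.unop)).comp (ρ.extendPath c hc a)) fun t m => ?_) x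
  have h1 : g • Q.snoc t a m = Q.snoc t a (g • m) :=
    congrArg (Q.consEquiv p a) (BalancedTensor.right_smul_tmul g t m)
  change ρ.extendPath c hc a (g • Q.snoc t a m) =
    (ρ.extendPath c hc a (Q.snoc t a m)).comp (ρ.vertex k g.unop)
  rw [h1, extendPath_snoc, extendPath_snoc, ← MulOpposite.op_unop g, ρ.arrow_right_smul]
  rfl

/-- The action of a tensor path by a homomorphism. -/
noncomputable def evalPath {i : Q.V} : ∀ {j : Q.V} (p : Quiver.Path i j),
    { c : Q.TensorPath p →ₗ[K] (P j →ₗ[A] P i) //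
      ∀ x (g : (Q.F j)ᵐᵒᵖ), c (g • x) = (c x).comp (ρ.vertex j g.unop) }
  | _, .nil => ⟨(ρ.vertex i).toLinearMap.comp (Q.nilEquiv i).symm.toLinearMap, fun x g => by
      obtain ⟨f, rfl⟩ := (Q.nilEquiv i).surjective x
      exact map_mul (ρ.vertex i) f g.unop⟩
  | _, .cons p a => ⟨ρ.extendPath (evalPath p).1 (evalPath p).2 a,
      ρ.extendPath_smul (evalPath p).1 (evalPath p).2 a⟩

theorem evalPath_nil (i : Q.V) (f : Q.F i) :
    (ρ.evalPath (.nil : Quiver.Path i i)).1 (Q.nilEquiv i f) = ρ.vertex i f := rfl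

theorem evalPath_snoc {i j k : Q.V} (p : Quiver.Path i j) (t : Q.TensorPath p) (a : j ⟶ k)
    (m : Q.bimodule a) :
    (ρ.evalPath (p.cons a)).1 (Q.snoc t a m) = ((ρ.evalPath p).1 t).comp (ρ.arrow a m) :=
  ρ.extendPath_snoc (ρ.evalPath p).1 (ρ.evalPath p).2 a t m

theorem evalPath_concat {i j k : Q.V} (p : Quiver.Path i j) (q : Quiver.Path j k)
    (x : Q.TensorPath p) (y : Q.TensorPath q) : (ρ.evalPath (p.comp q)).1 (Q.concat p q x y) =
      ((ρ.evalPath p).1 x).comp ((ρ.evalPath q).1 y) := by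
  induction q with
  | nil =>
    obtain ⟨f, rfl⟩ := (Q.nilEquiv j).surjective y
    rw [concat_nil]
    exact (ρ.evalPath p).2 x (MulOpposite.op f)
  | cons q a ih =>
    refine LinearMap.congr_fun (Q.tensorPath_cons_ext
      (g := (ρ.evalPath (p.comp (q.cons a))).1.comp (Q.concat p (q.cons a) x))
      (h := (compₗ i j _ ((ρ.evalPath p).1 x)).comp (ρ.evalPath (q.cons a)).1) fun t m => ?_) y
    rw [LinearMap.comp_apply, LinearMap.comp_apply, concat_snoc, evalPath_snoc]
    refine (ρ.evalPath_snoc (p.comp q) _ a m).trans ?_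
    rw [ih]
    rfl

open Classical in
/-- The action of a path sum by homomorphisms. -/
noncomputable def eval (i j : Q.V) : Q.PathSum i j →ₗ[K] (P j →ₗ[A] P i) :=
  DirectSum.toModule K _ _ (fun p => (ρ.evalPath p).1)

theorem eval_incl {i j : Q.V} (p : Quiver.Path i j) (x : Q.TensorPath p) :
    ρ.eval i j (Q.incl p x) = (ρ.evalPath p).1 x := by
  simp [eval, incl]

theorem eval_comp {i j k : Q.V} (x : Q.PathSum i j) (y : Q.PathSum j k) :
    ρ.eval i k (Q.comp i j k x y) = (ρ.eval i j x).comp (ρ.eval j k y) := by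
  have h1 : ∀ p (x : Q.TensorPath p), (ρ.eval i k).comp (Q.comp i j k (Q.incl p x)) =
      (compₗ i j k ((ρ.evalPath p).1 x)).comp (ρ.eval j k) := fun p x =>
    Q.pathSum_hom_ext fun q y => by
      rw [LinearMap.comp_apply, LinearMap.comp_apply, comp_incl, eval_incl, eval_incl,
        evalPath_concat]
      rfl
  have : (ρ.eval i k).comp ((Q.comp i j k).flip y) =
      ((compₗ i j k).flip (ρ.eval j k y)).comp (ρ.eval i j) :=
    Q.pathSum_hom_ext fun p x => by
      rw [LinearMap.comp_apply, LinearMap.comp_apply, eval_incl]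
      exact LinearMap.congr_fun (h1 p x) y
  exact LinearMap.congr_fun this x

theorem eval_arrowElt {i j : Q.V} (a : i ⟶ j) (m : Q.bimodule a) :
    ρ.eval i j (Q.arrowElt a m) = ρ.arrow a m := by
  rw [arrowElt_eq, eval_incl, evalPath_snoc, evalPath_nil, map_one]
  rfl

theorem eval_idPath (i : Q.V) : ρ.eval i i (Q.idPath i) = LinearMap.id := by
  rw [idPath, eval_incl, evalPath_nil, map_one]
  rfl

/-- If the algebras `F i` are the endomorphism algebras of the modules `P i`, and homomorphisms
`P k → P i` for `k ≠ i` have unique expansions in terms of elements of the arrow bimodules that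
generate these, then the tensor paths realize all homomorphisms faithfully. -/
theorem eval_bijective {B : Q.V → Type*} [∀ i, Fintype (B i)] {j : ∀ i, B i → Q.V}
    (a : ∀ i (b : B i), i ⟶ j i b) (m : ∀ i (b : B i), Q.bimodule (a i b))
    (hgen : ∀ {i k : Q.V} (c : i ⟶ k) (x : Q.bimodule c), ∃ y : ∀ b : B i, Q.PathSum (j i b) k,
      Q.arrowElt c x = ∑ b, Q.comp i (j i b) k (Q.arrowElt (a i b) (m i b)) (y b))
    (hvertex : ∀ i, Function.Bijective (ρ.vertex i))
    (hsurj : ∀ {i k : Q.V}, i ≠ k → ∀ f : P k →ₗ[A] P i, ∃ h : ∀ b : B i, P k →ₗ[A] P (j i b),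
      f = ∑ b, (ρ.arrow (a i b) (m i b)).comp (h b))
    (hinj : ∀ {i k : Q.V} (h : ∀ b : B i, P k →ₗ[A] P (j i b)),
      ∑ b, (ρ.arrow (a i b) (m i b)).comp (h b) = 0 → ∀ b, h b = 0)
    (r : Q.V → ℕ) (hr : ∀ {i k : Q.V}, Q.Arrow i k → r k < r i) (i k : Q.V) :
    Function.Bijective (ρ.eval i k) := by
  -- The rank `r` drops along arrows, so the coordinates of a homomorphism into `P i` live at
  -- vertices already treated.
  induction hn : r i using Nat.strong_induction_on generalizing i with
  | _ n ih =>
  subst hn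
  by_cases hik : i = k
  · subst hik
    constructor
    · rw [injective_iff_map_eq_zero]
      intro x hx
      obtain ⟨f, rfl⟩ := Q.exists_eq_nil x
      rw [eval_incl, evalPath_nil] at hx
      rw [(injective_iff_map_eq_zero (ρ.vertex i)).1 (hvertex i).1 f hx, map_zero, map_zero]
    · intro f
      obtain ⟨g, rfl⟩ := (hvertex i).2 f
      exact ⟨Q.incl .nil (Q.nilEquiv i g), by rw [eval_incl, evalPath_nil]⟩
  have hb : ∀ b, Function.Bijective (ρ.eval (j i b) k) := fun b =>
    ih _ (hr (a i b).down) _ rfl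
  have hsum : ∀ y : ∀ b : B i, Q.PathSum (j i b) k,
      ρ.eval i k (∑ b, Q.comp i (j i b) k (Q.arrowElt (a i b) (m i b)) (y b)) =
        ∑ b, (ρ.arrow (a i b) (m i b)).comp (ρ.eval (j i b) k (y b)) := fun y => by
    rw [map_sum]
    exact Finset.sum_congr rfl fun b _ => by rw [eval_comp, eval_arrowElt]
  constructor
  · rw [injective_iff_map_eq_zero]
    intro x hx
    -- Only the existence of coordinates in the path sum is needed: their uniqueness follows from
    -- `hinj` and the inductive hypothesis.
    obtain ⟨y, rfl⟩ : ∃ y : ∀ b : B i, Q.PathSum (j i b) k,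
        x = ∑ b, Q.comp i (j i b) k (Q.arrowElt (a i b) (m i b)) (y b) := by
      clear hx
      have := Q.mem_leftSpan_of_ne hik x
      rw [leftSpan] at this
      induction this using Submodule.span_induction with
      | mem x h =>
        obtain ⟨l, c, z, t, rfl⟩ := h
        obtain ⟨y, hy⟩ := hgen c z
        refine ⟨fun b => Q.comp _ _ _ (y b) t, ?_⟩
        rw [hy, map_sum, LinearMap.sum_apply]
        exact Finset.sum_congr rfl fun b _ => Q.comp_assoc _ _ _
      | zero => exact ⟨0, by simp⟩
      | add x x' _ _ h h' =>
        obtain ⟨y, rfl⟩ := h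
        obtain ⟨y', rfl⟩ := h'
        exact ⟨y + y', by simp [Finset.sum_add_distrib]⟩
      | smul c x _ h =>
        obtain ⟨y, rfl⟩ := h
        exact ⟨c • y, by simp [Finset.smul_sum]⟩
    rw [hsum] at hx
    refine Finset.sum_eq_zero fun b _ => ?_
    rw [(injective_iff_map_eq_zero _).1 (hb b).1 (y b) (hinj _ hx b), map_zero]
  · intro f
    obtain ⟨h, rfl⟩ := hsurj hik f
    choose y hy using fun b => (hb b).2 (h b)
    exact ⟨_, (hsum y).trans (Finset.sum_congr rfl fun b _ => by rw [hy])⟩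

/-- The action of the tensor algebra on the product of the modules `P i`. -/
noncomputable def toEndₗ : Q.TensorAlgebra →ₗ[K] Module.End A (∀ i, P i) where
  toFun x := LinearMap.pi fun i => ∑ j, (ρ.eval i j (x i j)).comp (LinearMap.proj j)
  map_add' x y := LinearMap.ext fun p => funext fun i => by
    simp [TensorAlgebra.add_apply, Finset.sum_add_distrib]
  map_smul' c x := LinearMap.ext fun p => funext fun i => by
    simp [TensorAlgebra.smul_apply, Finset.smul_sum]

theorem toEndₗ_apply (x : Q.TensorAlgebra) (p : ∀ i, P i) (i : Q.V) :
    ρ.toEndₗ x p i = ∑ j, ρ.eval i j (x i j) (p j) := by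
  simp [toEndₗ]

/-- The action of the tensor algebra on the product of the modules `P i`, as a homomorphism of
algebras. -/
noncomputable def toEnd : Q.TensorAlgebra →ₐ[K] Module.End A (∀ i, P i) :=
  AlgHom.ofLinearMap ρ.toEndₗ
    (LinearMap.ext fun p => funext fun i => by
      rw [toEndₗ_apply, Finset.sum_eq_single i]
      · rw [TensorAlgebra.one_apply_same, eval_idPath]; rfl
      · intro j _ hj
        rw [TensorAlgebra.one_apply_ne hj.symm, map_zero]; rfl
      · exact fun h => absurd (Finset.mem_univ i) h)
    (fun x y => LinearMap.ext fun p => funext fun i => by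
      rw [toEndₗ_apply, Module.End.mul_apply, toEndₗ_apply]
      simp only [TensorAlgebra.mul_apply, toEndₗ_apply, map_sum, LinearMap.sum_apply, eval_comp]
      exact Finset.sum_comm)

/-- An endomorphism of a finite product is a matrix of homomorphisms, and `toEnd` acts on its
entries by `eval`. -/
theorem toEnd_bijective (h : ∀ i j, Function.Bijective (ρ.eval i j)) :
    Function.Bijective ρ.toEnd := by
  classical
  have key : ∀ x i j (y : P j), ρ.toEnd x (Pi.single j y) i = ρ.eval i j (x i j) y := by
    intro x i j y
    refine (ρ.toEndₗ_apply x _ i).trans ?_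
    rw [Finset.sum_eq_single j]
    · rw [Pi.single_eq_same]
    · intro k _ hk
      rw [Pi.single_eq_of_ne hk, map_zero]
    · exact fun h => absurd (Finset.mem_univ j) h
  constructor
  · intro x y hxy
    refine TensorAlgebra.ext fun i j => (h i j).1 (LinearMap.ext fun z => ?_)
    rw [← key, hxy, key]
  · intro f
    choose x hx using fun i j => (h i j).2
      ((LinearMap.proj i).comp (f.comp (LinearMap.single A P j)))
    refine ⟨x, LinearMap.pi_ext fun j y => funext fun i => ?_⟩
    refine (key x i j y).trans ?_
    rw [hx]
    rfl

end Realization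

end ModulatedQuiver

/-! ## Algebras whose radical bimodules split -/

/-- Composition with a linear map on the left, as a homomorphism of groups. -/
def LinearMap.compLeftAddHom {R M N X : Type*} [Ring R] [AddCommGroup M] [Module R M]
    [AddCommGroup N] [Module R N] [AddCommGroup X] [Module R X] (f : N →ₗ[R] X) :
    (M →ₗ[R] N) →+ (M →ₗ[R] X) where
  toFun g := f.comp g
  map_zero' := LinearMap.comp_zero f
  map_add' g h := LinearMap.comp_add g h f

namespace SimpleSystem

variable {K : Type u} [Field K] {Λ : Type v} [Ring Λ] [Algebra K Λ] [Module.Finite K Λ]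
  {ι : Type w} (D : SimpleSystem K Λ ι)

/-- A basis of the bimodule `Hom(P j, rP i / r²P i)` over the division algebra `End(P j)`. -/
theorem exists_radTopHom_basis (hΛ : IsRightHereditary Λ) (i j : ι) :
    ∃ (β : Type v) (_ : Fintype β) (m : β → RadTopHom Λᵐᵒᵖ (D.P i) (D.P j)),
      (∀ g, ∃ c : β → Module.End Λᵐᵒᵖ (D.P j), g = ∑ l, MulOpposite.op (c l) • m l) ∧
      ∀ c : β → Module.End Λᵐᵒᵖ (D.P j), ∑ l, MulOpposite.op (c l) • m l = 0 → ∀ l, c l = 0 := by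
  have := finite_opposite (K := K) (Λ := Λ)
  have := (D.cover i).finite K
  have := (D.cover j).finite K
  have : Module.Finite K (RadTopHom Λᵐᵒᵖ (D.P i) (D.P j)) := RadTopHom.finite
  let := D.divisionRing hΛ j
  have hfree : Module.Free (Module.End Λᵐᵒᵖ (D.P j))ᵐᵒᵖ (RadTopHom Λᵐᵒᵖ (D.P i) (D.P j)) :=
    Module.Free.of_divisionRing (Module.End Λᵐᵒᵖ (D.P j))ᵐᵒᵖ (RadTopHom Λᵐᵒᵖ (D.P i) (D.P j))
  have hfin : Module.Finite (Module.End Λᵐᵒᵖ (D.P j))ᵐᵒᵖ (RadTopHom Λᵐᵒᵖ (D.P i) (D.P j)) :=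
    Module.Finite.of_restrictScalars_finite K _ _
  let b := Module.Free.chooseBasis (Module.End Λᵐᵒᵖ (D.P j))ᵐᵒᵖ (RadTopHom Λᵐᵒᵖ (D.P i) (D.P j))
  refine ⟨_, inferInstance, b, fun g => ⟨fun l => (b.repr g l).unop, (b.sum_repr g).symm⟩,
    fun c hc l => MulOpposite.op_injective ?_⟩
  exact Fintype.linearIndependent_iff.1 b.linearIndependent (fun l => MulOpposite.op (c l)) hc l

variable {D} in
/-- A section of `Hom(P j, rP i) → Hom(P j, rP i / r²P i)`, with values in `Hom(P j, P i)`. -/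
noncomputable def sectionMap {i j : ι}
    (σ : BimoduleHom (Module.End Λᵐᵒᵖ (D.P i)) (Module.End Λᵐᵒᵖ (D.P j))
      (RadTopHom Λᵐᵒᵖ (D.P i) (D.P j)) (RadHom Λᵐᵒᵖ (D.P i) (D.P j))) :
    RadTopHom Λᵐᵒᵖ (D.P i) (D.P j) →ₗ[K] (D.P j →ₗ[Λᵐᵒᵖ] D.P i) where
  toFun m := (Module.jacobson Λᵐᵒᵖ (D.P i)).subtype.comp (σ.toAddMonoidHom m : D.P j →ₗ[Λᵐᵒᵖ] _)
  map_add' m m' := by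
    rw [map_add]
    exact LinearMap.comp_add _ _ _
  map_smul' c m := by
    -- A bimodule section is only assumed additive and bilinear over the endomorphism rings;
    -- `K`-linearity follows since scalars act through `End(P i)`.
    have h : c • m = (c • (1 : Module.End Λᵐᵒᵖ (D.P i))) • m := by rw [smul_assoc, one_smul]
    rw [h]
    have h2 := σ.map_left_smul (c • (1 : Module.End Λᵐᵒᵖ (D.P i))) m
    exact congrArg (fun φ : D.P j →ₗ[Λᵐᵒᵖ] Rad Λᵐᵒᵖ (D.P i) =>
      (Module.jacobson Λᵐᵒᵖ (D.P i)).subtype.comp φ) h2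

variable [Fintype ι] (hΛ : IsRightHereditary Λ)

/-- The modules `P i`, as a family indexed by the vertices of the modulated quiver. -/
def vertexModule : (D.modulatedQuiver hΛ).V → Type v := D.P

instance (i : (D.modulatedQuiver hΛ).V) : AddCommGroup (D.vertexModule hΛ i) := D.addCommGroupP i

instance (i : (D.modulatedQuiver hΛ).V) : Module Λᵐᵒᵖ (D.vertexModule hΛ i) := D.moduleP i

instance (i : (D.modulatedQuiver hΛ).V) : Module K (D.vertexModule hΛ i) := D.moduleKP i

instance (i : (D.modulatedQuiver hΛ).V) : IsScalarTower K Λᵐᵒᵖ (D.vertexModule hΛ i) := D.towerP i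

/-- Sections of the projections `Hom(P j, rP i) → Hom(P j, rP i / r²P i)` give a realization of
the modulated quiver by the modules `P i`. -/
noncomputable def realization
    (σ : ∀ i j, D.Arrow i j → BimoduleHom (Module.End Λᵐᵒᵖ (D.P i)) (Module.End Λᵐᵒᵖ (D.P j))
      (RadTopHom Λᵐᵒᵖ (D.P i) (D.P j)) (RadHom Λᵐᵒᵖ (D.P i) (D.P j))) :
    (D.modulatedQuiver hΛ).Realization Λᵐᵒᵖ (D.vertexModule hΛ) where
  vertex := fun (i : ι) => AlgHom.id K (Module.End Λᵐᵒᵖ (D.P i))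
  arrow := @fun (i j : ι) a => sectionMap (σ i j a.down)
  arrow_left_smul := @fun (i j : ι) a f m =>
    congrArg (fun φ : D.P j →ₗ[Λᵐᵒᵖ] Rad Λᵐᵒᵖ (D.P i) =>
      (Module.jacobson Λᵐᵒᵖ (D.P i)).subtype.comp φ) ((σ i j a.down).map_left_smul f m)
  arrow_right_smul := @fun (i j : ι) a g m =>
    congrArg (fun φ : D.P j →ₗ[Λᵐᵒᵖ] Rad Λᵐᵒᵖ (D.P i) =>
      (Module.jacobson Λᵐᵒᵖ (D.P i)).subtype.comp φ)
      ((σ i j a.down).map_right_smul (MulOpposite.op g) m)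

/-- The sections lift bases of the arrow bimodules to components `s i b`, whose sum is an
isomorphism onto `rP i`. A map `P k → P i` with `k ≠ i` lands in `rP i`, so it has unique
coordinates along these components, as `Realization.eval_bijective` requires. -/
theorem realization_eval_bijective
    (σ : ∀ i j, D.Arrow i j → BimoduleHom (Module.End Λᵐᵒᵖ (D.P i)) (Module.End Λᵐᵒᵖ (D.P j))
      (RadTopHom Λᵐᵒᵖ (D.P i) (D.P j)) (RadHom Λᵐᵒᵖ (D.P i) (D.P j)))
    (hσ : ∀ i j h n, (radHomProj Λᵐᵒᵖ (D.P i) (D.P j)).toAddMonoidHom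
      ((σ i j h).toAddMonoidHom n) = n) (i k : ι) :
    Function.Bijective ((D.realization hΛ σ).eval i k) := by
  classical
  choose β hβ m hm1 hm2 using D.exists_radTopHom_basis hΛ
  let B : ι → Type (max v w) := fun i => Σ x : {j // D.Arrow i j}, β i x.1
  let s : ∀ i (b : B i), D.P b.1.1 →ₗ[Λᵐᵒᵖ] Rad Λᵐᵒᵖ (D.P i) := fun i b =>
    (σ i b.1.1 b.1.2).toAddMonoidHom (m i b.1.1 b.2)
  let hB : ∀ i, Fintype (B i) := fun i => inferInstance
  have hs : ∀ i (b : B i), (Module.jacobson Λᵐᵒᵖ (Rad Λᵐᵒᵖ (D.P i))).mkQ.comp (s i b) =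
      m i b.1.1 b.2 := fun i b => hσ i b.1.1 b.1.2 (m i b.1.1 b.2)
  have hsurj : ∀ i, Function.Surjective (D.radSum (s i)) := fun i => by
    refine D.radSum_surjective fun k g => ?_
    simp only [hs]
    by_cases hik : D.Arrow i k
    · obtain ⟨c, hc⟩ := hm1 i k g
      refine ⟨∑ l : β i k, Pi.single (⟨⟨k, hik⟩, l⟩ : B i) (c l), hc.trans ?_⟩
      exact (sum_apply_sum_single (N := fun b : B i => D.P k →ₗ[Λᵐᵒᵖ] D.P b.1.1)
        (fun b => LinearMap.compLeftAddHom (m i b.1.1 b.2))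
        (fun l : β i k => (⟨⟨k, hik⟩, l⟩ : B i)) c).symm
    -- Without an arrow there is nothing to generate: a nonzero map to `rP i / r²P i` would force
    -- `Ext¹` to be nonzero.
    · refine ⟨0, ?_⟩
      have hg : g = 0 := by
        by_contra hg
        exact hik (D.arrow_of_radTopHom_ne_zero g hg)
      rw [hg]
      exact (Finset.sum_eq_zero fun b _ => LinearMap.comp_zero _).symm
  have hinj : ∀ i, Function.Injective (D.radSum (s i)) := fun i => by
    refine D.radSum_injective hΛ (fun k c hc b hb => ?_) (hsurj i)
    obtain ⟨⟨j, hj⟩, l⟩ := b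
    obtain rfl : j = k := hb
    simp only [hs] at hc
    -- Terms at vertices other than `j` die modulo `r²P i`, which leaves a relation in the basis of
    -- a single bimodule.
    rw [Fintype.sum_sigma, Finset.sum_eq_single ⟨j, hj⟩] at hc
    · exact hm2 i j (fun l => c ⟨⟨j, hj⟩, l⟩) hc l
    · intro x _ hx
      refine Finset.sum_eq_zero fun l _ => D.radTop_comp_eq_zero (fun h => hx (Subtype.ext h)) _ _
    · exact fun h => absurd (Finset.mem_univ _) h
  have hcomp : ∀ {i k : ι} (h : ∀ b : B i, D.P k →ₗ[Λᵐᵒᵖ] D.P b.1.1) (x : D.P k),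
      (∑ b, ((Module.jacobson Λᵐᵒᵖ (D.P i)).subtype.comp (s i b)).comp (h b)) x =
        (D.radSum (s i) (fun b => h b x) : D.P i) := fun h x => by
    rw [radSum_apply, LinearMap.sum_apply]
    simp
  have hexists : ∀ {i k : ι}, i ≠ k → ∀ f : D.P k →ₗ[Λᵐᵒᵖ] D.P i,
      ∃ h : ∀ b : B i, D.P k →ₗ[Λᵐᵒᵖ] D.P b.1.1,
        f = ∑ b, ((Module.jacobson Λᵐᵒᵖ (D.P i)).subtype.comp (s i b)).comp (h b) := by
    intro i k hik f
    have := (D.cover k).projective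
    obtain ⟨h, hh⟩ := Module.projective_lifting_property (D.radSum (s i)) (D.toRad hik f) (hsurj i)
    refine ⟨fun b => (LinearMap.proj b).comp h, LinearMap.ext fun x => ?_⟩
    rw [hcomp]
    exact (congrArg Subtype.val (LinearMap.congr_fun hh x)).symm
  have hunique : ∀ {i k : ι} (h : ∀ b : B i, D.P k →ₗ[Λᵐᵒᵖ] D.P b.1.1),
      ∑ b, ((Module.jacobson Λᵐᵒᵖ (D.P i)).subtype.comp (s i b)).comp (h b) = 0 →
        ∀ b, h b = 0 := by
    intro i k h hh b
    refine LinearMap.ext fun x => ?_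
    have h2 : D.radSum (s i) (fun b => h b x) = 0 :=
      Subtype.ext ((hcomp h x).symm.trans (LinearMap.congr_fun hh x))
    exact congrFun ((injective_iff_map_eq_zero _).1 (hinj i) _ h2) b
  let hβ' : ∀ i j : (D.modulatedQuiver hΛ).V, Fintype (β i j) := hβ
  let hB' : ∀ i : (D.modulatedQuiver hΛ).V,
    Fintype (Σ x : {j // (D.modulatedQuiver hΛ).Arrow i j}, β i x.1) := hB
  exact (D.realization hΛ σ).eval_bijective
    (B := fun i => Σ x : {j // (D.modulatedQuiver hΛ).Arrow i j}, β i x.1) (j := fun i b => b.1.1)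
    (fun i b => ⟨b.1.2⟩) (fun i b => m i b.1.1 b.2)
    ((D.modulatedQuiver hΛ).exists_arrowElt_eq_sum (β := β) (fun i j _ l => m i j l)
      (fun i j _ x => hm1 i j x))
    (fun i => Function.bijective_id) hexists hunique
    (fun (i : ι) => Module.finrank K (D.P i)) (fun h => D.finrank_lt_of_arrow hΛ h) i k

/-- If the projections `Hom(P j, rP i) → Hom(P j, rP i / r²P i)` have sections, then the algebra is
Morita equivalent to the tensor algebra of its modulated quiver. -/
theorem isMoritaEquivalent_of_hasSection
    (h : ∀ i j, D.Arrow i j → (radHomProj Λᵐᵒᵖ (D.P i) (D.P j)).HasSection) :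
    IsMoritaEquivalent K Λᵐᵒᵖ (D.modulatedQuiver hΛ).TensorAlgebraᵐᵒᵖ := by
  classical
  have := finite_opposite (K := K) (Λ := Λ)
  choose σ hσ using h
  have hproj : ∀ i : ι, Module.Projective Λᵐᵒᵖ (D.P i) := fun i => (D.cover i).projective
  have hfin : ∀ i : ι, Module.Finite Λᵐᵒᵖ (D.P i) := fun i =>
    have := D.isNoetherian i
    inferInstance
  obtain ⟨α, _, k, f, p, hfp⟩ := D.exists_sum_eq_one
  have hfinP : Module.Finite Λᵐᵒᵖ (∀ i : ι, D.P i) := inferInstance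
  have hprojP : Module.Projective Λᵐᵒᵖ (∀ i : ι, D.P i) :=
    Module.Projective.of_equiv (DirectSum.linearEquivFunOnFintype Λᵐᵒᵖ ι D.P)
  let e : (D.modulatedQuiver hΛ).TensorAlgebra ≃ₐ[K] Module.End Λᵐᵒᵖ (∀ i : ι, D.P i) :=
    AlgEquiv.ofBijective (D.realization hΛ σ).toEnd
      ((D.realization hΛ σ).toEnd_bijective (D.realization_eval_bijective hΛ σ hσ))
  -- The sum of the `P i` is the progenerator; projecting to the factors `P (k a)` turns the
  -- expression of `1` by the `P i` into one by their sum.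
  refine isMoritaEquivalent_of_progenerator (AlgEquiv.op e)
    (f := fun a => (f a).comp (LinearMap.proj (k a))) (p := fun a => Pi.single (k a) (p a)) ?_
  rw [← hfp]
  exact Finset.sum_congr rfl fun a _ => by simp

end SimpleSystem

/-! ## The part of degree one of a path sum -/

namespace ModulatedQuiver

variable {K : Type u} [Field K] (Q : ModulatedQuiver.{u, v, w} K)

open Classical in
/-- The projection of a path sum onto the part of the paths of length one. -/
noncomputable def arrowPart (a b : Q.V) : Q.PathSum a b →ₗ[K] Q.PathSum a b :=
  DirectSum.toModule K _ _ (fun p => if p.length = 1 then Q.incl p else 0)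

theorem arrowPart_incl_of_eq {a b : Q.V} {p : Quiver.Path a b} (hp : p.length = 1)
    (t : Q.TensorPath p) : Q.arrowPart a b (Q.incl p t) = Q.incl p t := by
  simp only [arrowPart, incl, DirectSum.toModule_lof]
  rw [if_pos hp]

theorem arrowPart_incl_of_ne {a b : Q.V} {p : Quiver.Path a b} (hp : p.length ≠ 1)
    (t : Q.TensorPath p) : Q.arrowPart a b (Q.incl p t) = 0 := by
  simp only [arrowPart, incl, DirectSum.toModule_lof]
  rw [if_neg hp]
  rfl

/-- The part of a path sum given by the paths of length at least two. -/
noncomputable def longPart (a b : Q.V) : Submodule K (Q.PathSum a b) :=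
  Submodule.span K {x | ∃ (p : Quiver.Path a b) (t : Q.TensorPath p), 2 ≤ p.length ∧ x = Q.incl p t}

theorem incl_mem_longPart {a b : Q.V} {p : Quiver.Path a b} (hp : 2 ≤ p.length)
    (t : Q.TensorPath p) : Q.incl p t ∈ Q.longPart a b :=
  Submodule.subset_span ⟨p, t, hp, rfl⟩

theorem arrowPart_eq_zero {a b : Q.V} {x : Q.PathSum a b} (hx : x ∈ Q.longPart a b) :
    Q.arrowPart a b x = 0 := by
  have : Q.longPart a b ≤ LinearMap.ker (Q.arrowPart a b) := by
    rw [longPart, Submodule.span_le]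
    rintro _ ⟨p, t, hp, rfl⟩
    exact Q.arrowPart_incl_of_ne (by omega) t
  exact this hx

/-- Between distinct vertices there is no path of length zero, so deleting length one leaves only
lengths at least two. -/
theorem sub_arrowPart_mem {a b : Q.V} (hab : a ≠ b) (x : Q.PathSum a b) :
    x - Q.arrowPart a b x ∈ Q.longPart a b := by
  have : x ∈ (Q.longPart a b).comap (LinearMap.id - Q.arrowPart a b) := by
    refine Q.mem_of_incl_mem (fun p t => ?_) x
    change Q.incl p t - Q.arrowPart a b (Q.incl p t) ∈ Q.longPart a b
    by_cases hp : p.length = 1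
    · rw [Q.arrowPart_incl_of_eq hp, sub_self]
      exact Submodule.zero_mem _
    · rw [Q.arrowPart_incl_of_ne hp, sub_zero]
      have : p.length ≠ 0 := fun h => hab (Quiver.Path.eq_of_length_zero p h)
      exact Q.incl_mem_longPart (by omega) t
  exact this

/-- Both factors consist of paths of positive length, and lengths add. -/
theorem comp_mem_longPart {a b c : Q.V} (hab : a ≠ b) (hbc : b ≠ c) (x : Q.PathSum a b)
    (y : Q.PathSum b c) : Q.comp a b c x y ∈ Q.longPart a c := by
  have h1 : ∀ p (t : Q.TensorPath p), Q.comp a b c (Q.incl p t) y ∈ Q.longPart a c := fun p t => by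
    refine Q.mem_of_incl_mem (S := (Q.longPart a c).comap (Q.comp a b c (Q.incl p t)))
      (fun q s => ?_) y
    rw [Submodule.mem_comap, comp_incl]
    refine Q.incl_mem_longPart ?_ _
    have hp : p.length ≠ 0 := fun h => hab (Quiver.Path.eq_of_length_zero p h)
    have hq : q.length ≠ 0 := fun h => hbc (Quiver.Path.eq_of_length_zero q h)
    rw [Quiver.Path.length_comp]
    omega
  exact Q.mem_of_incl_mem (S := (Q.longPart a c).comap ((Q.comp a b c).flip y)) h1 x

/-- The elements of `longPart` are sums of products over intermediate vertices. -/
theorem longPart_le_span (a c : Q.V) : Q.longPart a c ≤ Submodule.span K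
    {x | ∃ (b : Q.V) (y : Q.PathSum a b) (z : Q.PathSum b c), a ≠ b ∧ b ≠ c ∧
      x = Q.comp a b c y z} := by
  rw [longPart, Submodule.span_le]
  rintro _ ⟨p, t, hp, rfl⟩
  cases p with
  | nil => exact absurd hp (by simp)
  | cons p e =>
    refine Q.incl_cons_mem (fun t m => ?_) t
    rw [incl_snoc]
    -- Split off the last arrow; acyclicity makes the intermediate vertex different from both ends.
    refine Submodule.subset_span ⟨_, _, _, ?_, ?_, rfl⟩
    · rintro rfl
      have := Q.length_eq_zero_of_cycle p
      rw [Quiver.Path.length_cons] at hp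
      omega
    · rintro rfl
      exact Q.acyclic _ (.single e.down)

/-- The motive need not be stable under scalars, since a scalar can be absorbed in the left factor
of a product. This matters because the identification of homomorphisms with path sums is merely
additive. -/
theorem longPart_induction {a c : Q.V} {motive : Q.PathSum a c → Prop} (zero : motive 0)
    (add : ∀ x y, motive x → motive y → motive (x + y))
    (comp : ∀ (b : Q.V) (y : Q.PathSum a b) (z : Q.PathSum b c), a ≠ b → b ≠ c →
      motive (Q.comp a b c y z)) {x : Q.PathSum a c} (hx : x ∈ Q.longPart a c) : motive x := by
  suffices ∀ r : K, motive (r • x) by simpa using this 1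
  have hx' := Q.longPart_le_span a c hx
  clear hx
  induction hx' using Submodule.span_induction with
  | mem x h =>
    obtain ⟨b, y, z, hab, hbc, rfl⟩ := h
    intro r
    have := comp b (r • y) z hab hbc
    rwa [map_smul, LinearMap.smul_apply] at this
  | zero => intro r; rwa [smul_zero]
  | add x y _ _ hx hy => intro r; rw [smul_add]; exact add _ _ (hx r) (hy r)
  | smul s x _ h => intro r; rw [smul_smul]; exact h (r * s)

/-- By acyclicity an element at a single vertex has length zero, so multiplying by it preserves the
length of paths. -/
theorem arrowPart_comp_left {a b : Q.V} (z : Q.PathSum a a) (x : Q.PathSum a b) :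
    Q.arrowPart a b (Q.comp a a b z x) = Q.comp a a b z (Q.arrowPart a b x) := by
  obtain ⟨f, rfl⟩ := Q.exists_eq_nil z
  refine LinearMap.congr_fun (f := (Q.arrowPart a b).comp (Q.comp a a b (Q.incl .nil _)))
    (g := (Q.comp a a b (Q.incl .nil _)).comp (Q.arrowPart a b)) (Q.pathSum_hom_ext fun p t => ?_) x
  have hl : (Quiver.Path.nil.comp p).length = p.length := by rw [Quiver.Path.nil_comp]
  rw [LinearMap.comp_apply, LinearMap.comp_apply, comp_incl]
  by_cases hp : p.length = 1
  · rw [arrowPart_incl_of_eq _ (hl.trans hp), arrowPart_incl_of_eq _ hp, comp_incl]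
  · rw [arrowPart_incl_of_ne _ (hl.trans_ne hp), arrowPart_incl_of_ne _ hp, map_zero]

theorem arrowPart_comp_right {a b : Q.V} (x : Q.PathSum a b) (z : Q.PathSum b b) :
    Q.arrowPart a b (Q.comp a b b x z) = Q.comp a b b (Q.arrowPart a b x) z := by
  obtain ⟨f, rfl⟩ := Q.exists_eq_nil z
  refine LinearMap.congr_fun (f := (Q.arrowPart a b).comp ((Q.comp a b b).flip (Q.incl .nil _)))
    (g := ((Q.comp a b b).flip (Q.incl .nil _)).comp (Q.arrowPart a b)) (Q.pathSum_hom_ext fun p t => ?_) x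
  rw [LinearMap.comp_apply, LinearMap.comp_apply, LinearMap.flip_apply, LinearMap.flip_apply,
    comp_incl]
  by_cases hp : p.length = 1
  · rw [arrowPart_incl_of_eq _ (p := p.comp .nil) hp, arrowPart_incl_of_eq _ hp, comp_incl]
  · rw [arrowPart_incl_of_ne _ (p := p.comp .nil) hp, arrowPart_incl_of_ne _ hp, map_zero]
    rfl

/-! ## Matrix units in the tensor algebra -/

namespace TensorAlgebra

variable {Q}

open Classical in
/-- The element of the tensor algebra with one given component. -/
noncomputable def single (a b : Q.V) (x : Q.PathSum a b) : Q.TensorAlgebra :=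
  Pi.single a (Pi.single b x)

theorem single_apply_same (a b : Q.V) (x : Q.PathSum a b) : single a b x a b = x := by
  classical
  simp [single]

theorem single_apply_of_ne_left {a b : Q.V} (x : Q.PathSum a b) {i : Q.V} (h : i ≠ a) (j : Q.V) :
    single a b x i j = 0 := by
  classical
  simp [single, Pi.single_eq_of_ne h]

theorem single_apply_of_ne_right {a b : Q.V} (x : Q.PathSum a b) (i : Q.V) {j : Q.V} (h : j ≠ b) :
    single a b x i j = 0 := by
  by_cases hi : i = a
  · subst hi
    classical
    simp [single, Pi.single_eq_of_ne h]
  · exact single_apply_of_ne_left x hi j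

theorem single_mul_single {a b c : Q.V} (x : Q.PathSum a b) (y : Q.PathSum b c) :
    single a b x * single b c y = single a c (Q.comp a b c x y) := by
  refine ext fun i j => ?_
  rw [mul_apply]
  by_cases hi : i = a
  · subst hi
    by_cases hj : j = c
    · subst hj
      rw [Finset.sum_eq_single b, single_apply_same, single_apply_same, single_apply_same]
      · intro k _ hk
        rw [single_apply_of_ne_right x i hk, map_zero, LinearMap.zero_apply]
      · exact fun h => absurd (Finset.mem_univ b) h
    · rw [single_apply_of_ne_right _ _ hj]
      exact Finset.sum_eq_zero fun k _ => by rw [single_apply_of_ne_right y k hj, map_zero]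
  · rw [single_apply_of_ne_left _ hi]
    refine Finset.sum_eq_zero fun k _ => ?_
    rw [single_apply_of_ne_left x hi k, map_zero, LinearMap.zero_apply]

theorem single_id_mul_apply (a : Q.V) (t : Q.TensorAlgebra) (j : Q.V) :
    (single a a (Q.idPath a) * t) a j = t a j := by
  rw [mul_apply, Finset.sum_eq_single a, single_apply_same, id_comp]
  · intro k _ hk
    rw [single_apply_of_ne_right _ a hk, map_zero, LinearMap.zero_apply]
  · exact fun h => absurd (Finset.mem_univ a) h

theorem mul_single_id_apply (b : Q.V) (t : Q.TensorAlgebra) (i : Q.V) :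
    (t * single b b (Q.idPath b)) i b = t i b := by
  rw [mul_apply, Finset.sum_eq_single b, single_apply_same, comp_id]
  · intro k _ hk
    rw [single_apply_of_ne_left _ hk b, map_zero]
  · exact fun h => absurd (Finset.mem_univ b) h

/-- The Peirce corner of two vertex idempotents is the path sum between the vertices. -/
theorem single_id_mul_mul_single_id (a b : Q.V) (t : Q.TensorAlgebra) :
    single a a (Q.idPath a) * t * single b b (Q.idPath b) = single a b (t a b) := by
  refine ext fun i j => ?_
  by_cases hj : j = b
  · subst hj
    rw [mul_single_id_apply]
    by_cases hi : i = a
    · subst hi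
      rw [single_id_mul_apply, single_apply_same]
    · rw [single_apply_of_ne_left _ hi, mul_apply]
      refine Finset.sum_eq_zero fun k _ => ?_
      rw [single_apply_of_ne_left _ hi k, map_zero, LinearMap.zero_apply]
  · rw [single_apply_of_ne_right _ _ hj, mul_apply]
    exact Finset.sum_eq_zero fun k _ => by rw [single_apply_of_ne_right _ k hj, map_zero]

theorem sum_single_id : ∑ a, single a a (Q.idPath a) = (1 : Q.TensorAlgebra) := by
  refine ext fun i j => ?_
  let ev : Q.TensorAlgebra →+ Q.PathSum i j :=
    { toFun := fun t => t i j, map_zero' := rfl, map_add' := fun _ _ => rfl }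
  refine (map_sum ev _ _).trans ?_
  change ∑ a, single a a (Q.idPath a) i j = _
  rw [Finset.sum_eq_single i]
  · by_cases h : i = j
    · subst h
      rw [single_apply_same, one_apply_same]
    · rw [single_apply_of_ne_right _ _ (Ne.symm h), one_apply_ne h]
  · intro k _ hk
    rw [single_apply_of_ne_left _ hk.symm]
  · exact fun h => absurd (Finset.mem_univ i) h

end TensorAlgebra

end ModulatedQuiver

/-! ## Morita equivalence with a tensor algebra -/

section Generator

universe u₁ u₂

/-- An equivalence of module categories maps the regular module to a projective generator with the
same endomorphism ring. -/
theorem exists_generator_of_equivalence {A : Type u₁} [Ring A] {B : Type u₂} [Ring B]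
    (E : ModuleCat.{max u₁ u₂} A ≌ ModuleCat.{max u₁ u₂} Bᵐᵒᵖ) [E.functor.Additive] :
    ∃ (Z : ModuleCat.{max u₁ u₂} A) (_ : Module.End A Z ≃+* B), Module.Projective A Z ∧
      ∀ X : ModuleCat.{max u₁ u₂} A, Nontrivial X → ∃ g : Z →ₗ[A] X, g ≠ 0 := by
  let U : ModuleCat.{max u₁ u₂} Bᵐᵒᵖ := ModuleCat.of Bᵐᵒᵖ (ULift.{max u₁ u₂} B)
  have hU : Projective U := by
    have : Module.Projective Bᵐᵒᵖ B :=
      Module.Projective.of_equiv (MulOpposite.opLinearEquiv Bᵐᵒᵖ : B ≃ₗ[Bᵐᵒᵖ] Bᵐᵒᵖ).symm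
    exact (IsProjective.iff_projective _).1 (inferInstance :
      Module.Projective Bᵐᵒᵖ (ULift.{max u₁ u₂} B))
  let Φ : Module.End Bᵐᵒᵖ U ≃+* Module.End A (E.inverse.obj U) :=
    { toFun := fun f => (E.inverse.map (ModuleCat.ofHom f)).hom
      invFun := fun g => (E.inverse.preimage (ModuleCat.ofHom g)).hom
      left_inv := fun f => by simp
      right_inv := fun g => by simp
      map_mul' := fun f g => by
        rw [Module.End.mul_eq_comp, ModuleCat.ofHom_comp, E.inverse.map_comp, ModuleCat.hom_comp]
        rfl
      map_add' := fun f g => by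
        rw [ModuleCat.ofHom_add, E.inverse.map_add, ModuleCat.hom_add] }
  let Ψ : B ≃+* Module.End Bᵐᵒᵖ U := (RingEquiv.moduleEndSelfOp B).trans
    (LinearEquiv.conjRingEquiv (ULift.moduleEquiv (R := Bᵐᵒᵖ) (M := B)).symm)
  refine ⟨E.inverse.obj U, (Ψ.trans Φ).symm, ?_, fun X hX => ?_⟩
  · have := (E.symm.map_projective_iff U).2 hU
    exact (IsProjective.iff_projective _).2 this
  -- The equivalence is faithful, so the image of a nonzero module has a nonzero element `y`; the
  -- map `1 ↦ y` from the regular module is carried back to one from `Z`.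
  · obtain ⟨y, hy⟩ : ∃ y : E.functor.obj X, y ≠ 0 := by
      by_contra! h
      have h1 : E.functor.map (𝟙 X) = E.functor.map 0 :=
        ModuleCat.hom_ext (LinearMap.ext fun y => (h _).trans (h _).symm)
      have h2 := congrArg ModuleCat.Hom.hom (E.functor.map_injective h1)
      obtain ⟨x, hx⟩ := exists_ne (0 : X)
      exact hx (LinearMap.congr_fun h2 x)
    let g : U →ₗ[Bᵐᵒᵖ] E.functor.obj X := (LinearMap.toSpanSingleton Bᵐᵒᵖ _ y).comp
      ((MulOpposite.opLinearEquiv Bᵐᵒᵖ : B ≃ₗ[Bᵐᵒᵖ] Bᵐᵒᵖ).toLinearMap.comp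
        (ULift.moduleEquiv (R := Bᵐᵒᵖ) (M := B)).toLinearMap)
    refine ⟨(E.inverse.map (ModuleCat.ofHom g) ≫ E.unitIso.inv.app X).hom, fun h0 => hy ?_⟩
    have h1 : E.inverse.map (ModuleCat.ofHom g) ≫ E.unitIso.inv.app X = 0 := ModuleCat.hom_ext h0
    rw [Preadditive.IsIso.comp_right_eq_zero] at h1
    have h2 := E.inverse.map_injective (h1.trans (E.inverse.map_zero _ _).symm)
    have h3 := LinearMap.congr_fun (congrArg ModuleCat.Hom.hom h2) ⟨1⟩
    have h4 : g ⟨1⟩ = y := one_smul Bᵐᵒᵖ y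
    exact h4.symm.trans h3

end Generator

/-! ### Recovering the modules `P i` and their homomorphisms from the tensor algebra -/

namespace SimpleSystem

variable {K : Type u} [Field K] {Λ : Type v} [Ring Λ] [Algebra K Λ]
  {ι : Type w} (D : SimpleSystem K Λ ι)

open ModulatedQuiver TensorAlgebra

/-- If the endomorphism ring of a projective generator is a tensor algebra, then each `P i` is
the direct summand given by some vertex. -/
theorem exists_vertex (Q : ModulatedQuiver K) {Z : Type*} [AddCommGroup Z] [Module Λᵐᵒᵖ Z]
    [Module.Projective Λᵐᵒᵖ Z] (Θ : Module.End Λᵐᵒᵖ Z ≃+* Q.TensorAlgebra) {i : ι}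
    {g : Z →ₗ[Λᵐᵒᵖ] D.S i} (hg : g ≠ 0) :
    ∃ (a : Q.V) (p : D.P i →ₗ[Λᵐᵒᵖ] Z) (q : Z →ₗ[Λᵐᵒᵖ] D.P i), q.comp p = LinearMap.id ∧
      Θ (p.comp q) = single a a (Q.idPath a) := by
  have := (D.cover i).projective
  let ε : Q.V → Module.End Λᵐᵒᵖ Z := fun a => Θ.symm (single a a (Q.idPath a))
  have hε : ∀ a, (ε a).comp (ε a) = ε a := fun a => by
    change ε a * ε a = ε a
    rw [← map_mul, single_mul_single, comp_id]
  have hε' : ∀ a x, ε a (ε a x) = ε a x := fun a x => LinearMap.congr_fun (hε a) x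
  obtain ⟨a, ha⟩ : ∃ a, g.comp (ε a) ≠ 0 := by
    by_contra! h
    apply hg
    have h1 : (∑ a, ε a) = LinearMap.id := by
      rw [← map_sum, sum_single_id, map_one]; rfl
    refine LinearMap.ext fun x => ?_
    have h2 := congrArg g (LinearMap.congr_fun h1 x)
    rw [LinearMap.sum_apply, map_sum] at h2
    exact h2.symm.trans (Finset.sum_eq_zero fun a _ => LinearMap.congr_fun (h a) x)
  -- The lift of `g ∘ ε a` to `P i` is surjective because its image is not in the radical, and it
  -- splits because `P i` is projective. This exhibits `P i` as a summand of `ε a Z`.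
  obtain ⟨q₀, hq₀⟩ := Module.projective_lifting_property (D.π i) (g.comp (ε a))
    (D.cover i).surjective
  have hq : (D.π i).comp (q₀.comp (ε a)) = g.comp (ε a) := by
    rw [← LinearMap.comp_assoc, hq₀, LinearMap.comp_assoc, hε]
  have hsurj := (D.cover i).surjective_of_comp_ne_zero (q₀.comp (ε a)) (by rwa [hq])
  obtain ⟨p₀, hp₀⟩ := Module.projective_lifting_property (q₀.comp (ε a)) LinearMap.id hsurj
  have hqp : (q₀.comp (ε a)).comp ((ε a).comp p₀) = LinearMap.id := by
    rw [← hp₀]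
    exact LinearMap.ext fun x => congrArg q₀ (hε' a (p₀ x))
  refine ⟨a, (ε a).comp p₀, q₀.comp (ε a), hqp, ?_⟩
  let e : Module.End Λᵐᵒᵖ Z := ((ε a).comp p₀).comp (q₀.comp (ε a))
  have hee : e * e = e := by
    change (((ε a).comp p₀).comp (q₀.comp (ε a))).comp (((ε a).comp p₀).comp (q₀.comp (ε a))) = _
    rw [LinearMap.comp_assoc, ← LinearMap.comp_assoc _ _ (q₀.comp (ε a)), hqp, LinearMap.id_comp]
  -- The idempotent `e` onto this summand lies in the corner at `a`, which is the division algebra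
  -- `F a`. Being nonzero, it is the identity there, so the summand is all of `ε a Z`.
  have he : Θ e = single a a (Θ e a a) := by
    rw [← single_id_mul_mul_single_id, ← Θ.apply_symm_apply (single a a (Q.idPath a)), ← map_mul,
      ← map_mul]
    congr 1
    refine LinearMap.ext fun x => ?_
    change ε a (p₀ (q₀ (ε a x))) = ε a (ε a (p₀ (q₀ (ε a (ε a x)))))
    rw [hε', hε']
  obtain ⟨f, hf⟩ := Q.exists_eq_nil (Θ e a a)
  have hff : f * f = f := by
    have h1 : Θ e * Θ e = Θ e := by rw [← map_mul, hee]
    rw [he, single_mul_single, hf, comp_incl, concat_nil, smul_nilEquiv] at h1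
    have h2 := congrFun (congrFun h1 a) a
    rw [single_apply_same, single_apply_same] at h2
    classical
    exact (Q.nilEquiv a).injective (DirectSum.of_injective (β := fun p => Q.TensorPath p) _ h2)
  have hf0 : f ≠ 0 := by
    rintro rfl
    have h0 : Θ e = 0 := by
      rw [he, hf, map_zero, map_zero]
      classical
      simp [single]
      rfl
    have he0 : e = 0 := by rwa [map_eq_zero_iff Θ Θ.injective] at h0
    have := (D.cover i).nontrivial
    obtain ⟨x, hx⟩ := exists_ne (0 : D.P i)
    have h3 : ((q₀.comp (ε a)).comp ((ε a).comp p₀)).comp ((q₀.comp (ε a)).comp ((ε a).comp p₀)) =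
        (q₀.comp (ε a)).comp (e.comp ((ε a).comp p₀)) := rfl
    rw [hqp, he0, LinearMap.zero_comp, LinearMap.comp_zero] at h3
    exact hx (LinearMap.congr_fun h3 x)
  have hf1 : f = 1 := mul_left_cancel₀ hf0 (hff.trans (mul_one f).symm)
  change Θ e = _
  rw [he, hf, hf1]
  rfl

/-- If the endomorphism ring of a projective generator is a tensor algebra, then the homomorphisms
between the `P i` are given by path sums. -/
theorem exists_hom_equiv (Q : ModulatedQuiver K) {Z : Type*} [AddCommGroup Z] [Module Λᵐᵒᵖ Z]
    [Module.Projective Λᵐᵒᵖ Z] (Θ : Module.End Λᵐᵒᵖ Z ≃+* Q.TensorAlgebra)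
    (hZ : ∀ i, ∃ g : Z →ₗ[Λᵐᵒᵖ] D.S i, g ≠ 0) :
    ∃ (σ : ι → Q.V) (Φ : ∀ i j, (D.P j →ₗ[Λᵐᵒᵖ] D.P i) ≃+ Q.PathSum (σ i) (σ j)),
      Function.Injective σ ∧ ∀ i j k (f : D.P j →ₗ[Λᵐᵒᵖ] D.P i) (g : D.P k →ₗ[Λᵐᵒᵖ] D.P j),
        Φ i k (f.comp g) = Q.comp (σ i) (σ j) (σ k) (Φ i j f) (Φ j k g) := by
  choose g hg using hZ
  choose σ p q hqp hpq using fun i => D.exists_vertex Q Θ (hg i)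
  have hqp' : ∀ i x, q i (p i x) = x := fun i x => LinearMap.congr_fun (hqp i) x
  -- Conjugation by the inclusions and projections places `Hom(P j, P i)` in the corner of `End(Z)`
  -- at the vertices `σ i` and `σ j`.
  have key : ∀ i j (f : D.P j →ₗ[Λᵐᵒᵖ] D.P i), Θ ((p i).comp (f.comp (q j))) =
      single (σ i) (σ j) (Θ ((p i).comp (f.comp (q j))) (σ i) (σ j)) := fun i j f => by
    rw [← single_id_mul_mul_single_id, ← hpq, ← hpq, ← map_mul, ← map_mul]
    congr 1
    refine LinearMap.ext fun x => ?_
    simp [hqp']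
  let Φ : ∀ i j, (D.P j →ₗ[Λᵐᵒᵖ] D.P i) ≃+ Q.PathSum (σ i) (σ j) := fun i j =>
    { toFun := fun f => Θ ((p i).comp (f.comp (q j))) (σ i) (σ j)
      invFun := fun x => (q i).comp (LinearMap.comp (Θ.symm (single (σ i) (σ j) x)) (p j))
      left_inv := fun f => by
        beta_reduce
        rw [← key, Θ.symm_apply_apply]
        refine LinearMap.ext fun x => ?_
        simp [hqp']
      right_inv := fun x => by
        have h1 : (p i).comp (((q i).comp (LinearMap.comp (Θ.symm (single (σ i) (σ j) x))
            (p j))).comp (q j)) = ((p i).comp (q i) : Module.End Λᵐᵒᵖ Z) *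
              Θ.symm (single (σ i) (σ j) x) * ((p j).comp (q j) : Module.End Λᵐᵒᵖ Z) := rfl
        beta_reduce
        rw [h1, map_mul, map_mul, hpq, hpq, Θ.apply_symm_apply, single_id_mul_mul_single_id,
          single_apply_same, single_apply_same]
      map_add' := fun f g => by
        rw [← TensorAlgebra.add_apply, ← map_add, LinearMap.add_comp, LinearMap.comp_add] }
  refine ⟨σ, Φ, fun i j hij => ?_, fun i j k f g => ?_⟩
  -- Equal vertices give equal idempotents on `Z`, so `q j ∘ p i` has nonzero composite with `π j`;
  -- then `S j` is a quotient of `P i`, which forces `i = j`.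
  · have h1 : (p i).comp (q i) = (p j).comp (q j) := by
      apply Θ.injective
      rw [hpq, hpq, hij]
    have h2 : ∀ x, p i (q i x) = p j (q j x) := fun x => LinearMap.congr_fun h1 x
    have h3 : (D.π j).comp ((q j).comp (p i)) ≠ 0 := fun h => by
      refine (D.cover j).ne_zero (LinearMap.ext fun x => ?_)
      have := LinearMap.congr_fun h (q i (p j x))
      simpa [h2, hqp'] using this
    obtain ⟨e⟩ := (D.cover i).nonempty_equiv_of_ne_zero _ h3
    exact (D.eq_of_iso j i ⟨e⟩).symm
  · change Θ _ _ _ = Q.comp _ _ _ (Θ _ _ _) (Θ _ _ _)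
    have h1 : (p i).comp ((f.comp g).comp (q k)) =
        ((p i).comp (f.comp (q j)) : Module.End Λᵐᵒᵖ Z) *
          ((p j).comp (g.comp (q k)) : Module.End Λᵐᵒᵖ Z) := by
      refine LinearMap.ext fun x => ?_
      simp [hqp']
    rw [h1, map_mul, key i j, key j k, single_mul_single, single_apply_same, single_apply_same,
      single_apply_same]

end SimpleSystem

/-! ### From path sums back to bimodule sections -/

namespace SimpleSystem

variable {K : Type u} [Field K] {Λ : Type v} [Ring Λ] [Algebra K Λ]
  {ι : Type w} (D : SimpleSystem K Λ ι)

/-- A bimodule endomorphism of `Hom(P j, P i)` that is a projection modulo the kernel of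
`Hom(P j, rP i) → Hom(P j, rP i / r²P i)` and vanishes on this kernel provides a section. -/
theorem hasSection_of_endomorphism {i j : ι} (hij : i ≠ j)
    (N : (D.P j →ₗ[Λᵐᵒᵖ] D.P i) →+ (D.P j →ₗ[Λᵐᵒᵖ] D.P i))
    (hleft : ∀ (f : Module.End Λᵐᵒᵖ (D.P i)) g, N (f.comp g) = f.comp (N g))
    (hright : ∀ (f : Module.End Λᵐᵒᵖ (D.P j)) (g : D.P j →ₗ[Λᵐᵒᵖ] D.P i),
      N (g.comp f) = (N g).comp f)
    (hker : ∀ φ : D.P j →ₗ[Λᵐᵒᵖ] Rad Λᵐᵒᵖ (D.P i),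
      (∀ x, φ x ∈ Module.jacobson Λᵐᵒᵖ (Rad Λᵐᵒᵖ (D.P i))) →
        N ((Module.jacobson Λᵐᵒᵖ (D.P i)).subtype.comp φ) = 0)
    (hproj : ∀ g x, D.toRad hij (g - N g) x ∈ Module.jacobson Λᵐᵒᵖ (Rad Λᵐᵒᵖ (D.P i))) :
    (radHomProj Λᵐᵒᵖ (D.P i) (D.P j)).HasSection := by
  have := (D.cover j).projective
  let pr : (D.P j →ₗ[Λᵐᵒᵖ] Rad Λᵐᵒᵖ (D.P i)) → (D.P j →ₗ[Λᵐᵒᵖ] RadTop Λᵐᵒᵖ (D.P i)) :=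
    fun φ => (Module.jacobson Λᵐᵒᵖ (Rad Λᵐᵒᵖ (D.P i))).mkQ.comp φ
  let sub : (D.P j →ₗ[Λᵐᵒᵖ] Rad Λᵐᵒᵖ (D.P i)) → (D.P j →ₗ[Λᵐᵒᵖ] D.P i) :=
    fun φ => (Module.jacobson Λᵐᵒᵖ (D.P i)).subtype.comp φ
  have hpr : ∀ φ, ∃ ψ, pr ψ = φ := fun φ =>
    Module.projective_lifting_property _ φ (Submodule.mkQ_surjective _)
  choose lift hlift using hpr
  -- Since `N` kills maps into `r²P i`, its value does not depend on the chosen lift. Thus `ψ ↦ N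
  -- (lift ψ)` inherits additivity and both linearities, although the lifts are arbitrary.
  have hN : ∀ φ ψ, pr φ = pr ψ → N (sub φ) = N (sub ψ) := fun φ ψ h => by
    rw [← sub_eq_zero, ← map_sub]
    rw [show sub φ - sub ψ = sub (φ - ψ) from (LinearMap.comp_sub _ _ _).symm]
    refine hker (φ - ψ) fun x => ?_
    rw [← Submodule.Quotient.mk_eq_zero, ← Submodule.mkQ_apply, LinearMap.sub_apply, map_sub,
      sub_eq_zero]
    exact LinearMap.congr_fun h x
  have hN' : ∀ φ ψ, pr φ = ψ → N (sub (lift ψ)) = N (sub φ) := fun φ ψ h =>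
    hN _ _ ((hlift ψ).trans h.symm)
  refine ⟨{ toFun := fun ψ => D.toRad hij (N (sub (lift ψ)))
            map_zero' := ?_
            map_add' := fun ψ ψ' => ?_
            map_left_smul := fun f ψ => ?_
            map_right_smul := fun f ψ => ?_ }, fun ψ => ?_⟩
  · have h0 : N (sub (lift 0)) = 0 := (hN' 0 0 (LinearMap.comp_zero _)).trans
      ((congrArg N (LinearMap.comp_zero _)).trans (map_zero N))
    exact congrArg (D.toRad hij) h0
  · rw [hN' (lift ψ + lift ψ') (ψ + ψ') ((LinearMap.comp_add _ _ _).trans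
      (congrArg₂ (· + ·) (hlift ψ) (hlift ψ'))),
      show sub (lift ψ + lift ψ') = sub (lift ψ) + sub (lift ψ') from LinearMap.comp_add _ _ _,
      map_add]
    rfl
  · rw [hN' ((radMap f).comp (lift ψ)) (f • ψ)
      (congrArg (fun φ => (radTopMap f).comp φ) (hlift ψ)),
      show sub ((radMap f).comp (lift ψ)) = f.comp (sub (lift ψ)) from rfl, hleft]
    rfl
  · rw [hN' ((lift ψ).comp f.unop) (f • ψ)
      (congrArg (fun φ : D.P j →ₗ[Λᵐᵒᵖ] _ => φ.comp f.unop) (hlift ψ)),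
      show sub ((lift ψ).comp f.unop) = (sub (lift ψ)).comp f.unop from rfl, hright]
    rfl
  · refine Eq.trans ?_ (hlift ψ)
    refine LinearMap.ext fun x => ?_
    refine ((Submodule.Quotient.eq _).2 ?_).symm
    exact hproj (sub (lift ψ)) x

variable [Module.Finite K Λ]

/-- A nonzero endomorphism of `P i` is an automorphism, which cannot have its image in the proper
submodule `rP i`. -/
theorem eq_zero_of_mem_jacobson (hΛ : IsRightHereditary Λ) {i : ι}
    (f : Module.End Λᵐᵒᵖ (D.P i)) (hf : ∀ x, f x ∈ Module.jacobson Λᵐᵒᵖ (D.P i)) : f = 0 := by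
  have := finite_opposite (K := K) (Λ := Λ)
  refine ((D.cover i).isUnit_or_eq_zero K hΛ f).resolve_left fun hu => ?_
  refine (D.cover i).isCoatom_ker.1 (eq_top_iff.2 fun x _ => ?_)
  obtain ⟨y, rfl⟩ := ((Module.End.isUnit_iff f).1 hu).2 x
  rw [← (D.cover i).jacobson_eq_ker]
  exact hf y

/-- If the homomorphisms between the `P i` are given by the path sums of a modulated quiver, then
the projections `Hom(P j, rP i) → Hom(P j, rP i / r²P i)` have sections. -/
theorem hasSection_of_hom_equiv (hΛ : IsRightHereditary Λ) (Q : ModulatedQuiver K) (σ : ι → Q.V)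
    (hσ : Function.Bijective σ)
    (Φ : ∀ i j, (D.P j →ₗ[Λᵐᵒᵖ] D.P i) ≃+ Q.PathSum (σ i) (σ j))
    (hΦ : ∀ i j k (f : D.P j →ₗ[Λᵐᵒᵖ] D.P i) (g : D.P k →ₗ[Λᵐᵒᵖ] D.P j),
      Φ i k (f.comp g) = Q.comp (σ i) (σ j) (σ k) (Φ i j f) (Φ j k g))
    {i j : ι} (hij : i ≠ j) : (radHomProj Λᵐᵒᵖ (D.P i) (D.P j)).HasSection := by
  -- Transport of the projection onto paths of length one.
  let N : (D.P j →ₗ[Λᵐᵒᵖ] D.P i) →+ (D.P j →ₗ[Λᵐᵒᵖ] D.P i) :=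
    (Φ i j).symm.toAddMonoidHom.comp
      ((Q.arrowPart (σ i) (σ j)).toAddMonoidHom.comp (Φ i j).toAddMonoidHom)
  have hN : ∀ g, Φ i j (N g) = Q.arrowPart (σ i) (σ j) (Φ i j g) := fun g =>
    (Φ i j).apply_symm_apply _
  have hΦ0 : ∀ {i k : ι} (f : D.P k →ₗ[Λᵐᵒᵖ] D.P i), f = 0 → Φ i k f ∈ Q.longPart (σ i) (σ k) :=
    fun f hf => by rw [hf, map_zero]; exact Submodule.zero_mem _
  refine D.hasSection_of_endomorphism hij N (fun f g => (Φ i j).injective ?_)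
    (fun f g => (Φ i j).injective ?_) (fun φ hφ => (Φ i j).injective ?_) (fun g => ?_)
  · rw [hN, hΦ, hΦ, hN, Q.arrowPart_comp_left]
  · rw [hN, hΦ, hΦ, hN, Q.arrowPart_comp_right]
  · rw [hN, map_zero]
    apply Q.arrowPart_eq_zero
    have := D.isNoetherian (K := K) i
    have := (D.cover i).projective_submodule hΛ (Module.jacobson Λᵐᵒᵖ (D.P i))
    -- A map into `r²P i` is factored through projectives `P (k a)` covering `rP i`. The terms with
    -- `k a = i` or `k a = j` vanish by `eq_zero_of_mem_jacobson`; in the second case because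
    -- homomorphisms carry `r(rP i)` into `rP j`. The other terms pass through a third vertex and so
    -- are sums of paths of length at least two.
    obtain ⟨α, _, k, s, t, hst⟩ := D.exists_factorization (Rad Λᵐᵒᵖ (D.P i))
    have hsum : (Module.jacobson Λᵐᵒᵖ (D.P i)).subtype.comp φ =
        ∑ a, ((Module.jacobson Λᵐᵒᵖ (D.P i)).subtype.comp (t a)).comp ((s a).comp φ) := by
      refine LinearMap.ext fun x => ?_
      rw [LinearMap.sum_apply]
      have := congrArg (Module.jacobson Λᵐᵒᵖ (D.P i)).subtype (hst (φ x))
      rw [map_sum] at this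
      exact this.symm
    rw [hsum, map_sum]
    refine Submodule.sum_mem _ fun a _ => ?_
    by_cases hi : i = k a
    · apply hΦ0
      have : ∀ (l : ι) (hl : i = l) (t : D.P l →ₗ[Λᵐᵒᵖ] Rad Λᵐᵒᵖ (D.P i)),
          (Module.jacobson Λᵐᵒᵖ (D.P i)).subtype.comp t = 0 := by
        rintro l rfl t
        exact D.eq_zero_of_mem_jacobson (K := K) hΛ _ fun x => (t x).2
      rw [this _ hi, LinearMap.zero_comp]
    by_cases hj : k a = j
    · apply hΦ0
      have : ∀ (l : ι) (hl : l = j) (s : Rad Λᵐᵒᵖ (D.P i) →ₗ[Λᵐᵒᵖ] D.P l), s.comp φ = 0 := by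
        rintro l rfl s
        exact D.eq_zero_of_mem_jacobson (K := K) hΛ _ fun x => Module.le_comap_jacobson s (hφ x)
      rw [this _ hj, LinearMap.comp_zero]
    rw [hΦ]
    exact Q.comp_mem_longPart (hσ.1.ne hi) (hσ.1.ne hj) _ _
  · have hmem : Φ i j (g - N g) ∈ Q.longPart (σ i) (σ j) := by
      rw [map_sub, hN]
      exact Q.sub_arrowPart_mem (hσ.1.ne hij) _
    -- Conversely, a long element is a sum of products through vertices other than both ends.
    -- Surjectivity of `σ` turns each into a composite through some `P l`, with both factors
    -- radical, hence a map into `r²P i`.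
    have hlong : ∀ x ∈ Q.longPart (σ i) (σ j), ∀ y, D.toRad hij ((Φ i j).symm x) y ∈
        Module.jacobson Λᵐᵒᵖ (Rad Λᵐᵒᵖ (D.P i)) := by
      intro x hx
      refine Q.longPart_induction (motive := fun x => ∀ y, D.toRad hij ((Φ i j).symm x) y ∈
        Module.jacobson Λᵐᵒᵖ (Rad Λᵐᵒᵖ (D.P i))) (fun y => ?_) (fun x x' h h' y => ?_)
        (fun b z z' hb hb' y => ?_) hx
      · rw [map_zero]
        exact Submodule.zero_mem _
      · rw [map_add]
        exact Submodule.add_mem _ (h y) (h' y)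
      · obtain ⟨l, rfl⟩ := hσ.2 b
        have hil : i ≠ l := fun h => hb (congrArg σ h)
        have hlj : l ≠ j := fun h => hb' (congrArg σ h)
        have hcomp : (Φ i j).symm (Q.comp (σ i) (σ l) (σ j) z z') =
            ((Φ i l).symm z).comp ((Φ l j).symm z') := by
          rw [AddEquiv.symm_apply_eq, hΦ, AddEquiv.apply_symm_apply, AddEquiv.apply_symm_apply]
        rw [hcomp]
        exact (Submodule.Quotient.mk_eq_zero _).1 (LinearMap.congr_fun
          (D.radTop_comp_eq_zero hlj ((Module.jacobson Λᵐᵒᵖ (Rad Λᵐᵒᵖ (D.P i))).mkQ.comp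
            (D.toRad hil ((Φ i l).symm z))) ((Φ l j).symm z')) y)
    have := hlong _ hmem
    rwa [AddEquiv.symm_apply_apply] at this

open scoped ModuleCat.Algebra in
/-- If a hereditary algebra is Morita equivalent to the tensor algebra of its modulated quiver, then
the projections `Hom(P j, rP i) → Hom(P j, rP i / r²P i)` have sections. -/
theorem hasSection_of_isMoritaEquivalent (hΛ : IsRightHereditary Λ) [Fintype ι]
    (h : IsMoritaEquivalent K Λᵐᵒᵖ (D.modulatedQuiver hΛ).TensorAlgebraᵐᵒᵖ) {i j : ι}
    (hij : i ≠ j) : (radHomProj Λᵐᵒᵖ (D.P i) (D.P j)).HasSection := by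
  obtain ⟨⟨M⟩⟩ := h
  obtain ⟨Z, Θ, hZ, hgen⟩ := exists_generator_of_equivalence M.eqv
  have hS : ∀ i, ∃ g : Z →ₗ[Λᵐᵒᵖ] D.S i, g ≠ 0 := fun i => by
    have := IsSimpleModule.nontrivial Λᵐᵒᵖ (D.S i)
    obtain ⟨g, hg⟩ := hgen (ModuleCat.of Λᵐᵒᵖ (ULift.{max v w} (D.S i))) inferInstance
    refine ⟨ULift.moduleEquiv.toLinearMap.comp g, fun h0 => hg (LinearMap.ext fun x => ?_)⟩
    exact ULift.down_injective (LinearMap.congr_fun h0 x)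
  obtain ⟨σ, Φ, hσ, hΦ⟩ := D.exists_hom_equiv (D.modulatedQuiver hΛ) Θ hS
  -- The quiver has `ι` itself as its set of vertices, so the injection `σ` is a bijection by
  -- counting.
  exact D.hasSection_of_hom_equiv hΛ (D.modulatedQuiver hΛ) σ
    (Finite.injective_iff_bijective (α := ι).1 hσ) Φ hΦ hij

end SimpleSystem

theorem theorem5p0p1 {K : Type u} [Field K] {Λ : Type v} [Ring Λ] [Algebra K Λ]
    [Module.Finite K Λ] (hΛ : IsRightHereditary Λ) {ι : Type w} [Fintype ι]
    (D : SimpleSystem K Λ ι) :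
    IsMoritaEquivalent K Λᵐᵒᵖ (D.modulatedQuiver hΛ).TensorAlgebraᵐᵒᵖ ↔
      ∀ i j : ι, D.Arrow i j → (radHomProj Λᵐᵒᵖ (D.P i) (D.P j)).HasSection := by
  -- Acyclicity excludes loops, so every arrow joins distinct vertices, as the construction of the
  -- section requires.
  refine ⟨fun h i j hij => D.hasSection_of_isMoritaEquivalent hΛ h fun hne => ?_,
    D.isMoritaEquivalent_of_hasSection hΛ⟩
  subst hne
  exact D.acyclic hΛ i (.single hij)
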